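/- For $n\in\mathbb N$ put $$\alpha(n)=2^{-n^{1/4}\sqrt{\log n}/64},\qquad \beta(n)=\frac{n^{-3/4}\sqrt{\log n}}{128},\qquad P(n)=2^{n^{1/4}\sqrt{\log n}/32},$$ where $\log$ is the natural logarithm. Let $M_n$ be chosen uniformly at random from the set of all symmetric $n\times n$ matrices with entries in $\{1,-1\}$. For a prime $p$, a real $\mu\in[0,1]$ and $a=(a_1,\dots,a_n)\in\mathbb F_p^n$, the $\mu$-atom probability of $a$ is $$\rho_\mu(a)=\sup_{c\in\mathbb F_p}\Pr\left[a_1x_1+\dots+a_nx_n=c\right],$$ where $x_1,\dots,x_n$ are i.i.d. random variables taking the value $0$ with probability $\mu$ and each of the values $1$ and $-1$ with probability $(1-\mu)/2$. There is $N\in\mathbb N$ such that for every $n\ge N$ and every prime $p$ with $P(n)\le p\le 2P(n)$ the following holds. With probability at least $1-2^{-n/32}$ over $M_n$, every nonzero vector $a\in\mathbb F_p^n$ that is orthogonal over $\mathbb F_p$ to at least $(1-\beta(n))n$ rows of $M_n$ satisfies $\rho_\mu(a)\le\alpha(n)$ for all $0\le\mu\le 1/2$. -/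

import Mathlib

open MeasureTheory ProbabilityTheory

noncomputable section

/-- The law on the integers giving mass `μ` to `0` and mass `(1 - μ) / 2` to each of `1`, `-1`. -/
def lazySign (μ : ℝ) : Measure ℤ :=
  ENNReal.ofReal μ • Measure.dirac 0 + ENNReal.ofReal ((1 - μ) / 2) • Measure.dirac 1 +
    ENNReal.ofReal ((1 - μ) / 2) • Measure.dirac (-1)

/-- The `μ`-atom probability of a vector `a` over a ring `R`: the supremum over `c` of the
probability that `a₁ x₁ + ⋯ + aₙ xₙ = c`, where the `xᵢ` are i.i.d. with law `lazySign μ`. -/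
def atomProb {R : Type*} [Ring R] {n : ℕ} (μ : ℝ) (a : Fin n → R) : ℝ :=
  ⨆ c : R, (Measure.pi fun _ : Fin n => lazySign μ).real {x | ∑ i, a i * (x i : R) = c}

/-- The set of symmetric `n × n` matrices with entries `1` and `-1`. -/
def symmSignMatrices (n : ℕ) : Set (Matrix (Fin n) (Fin n) ℤ) :=
  {M | M.IsSymm ∧ ∀ i j, M i j = 1 ∨ M i j = -1}

/-- Every set of integer matrices is an event. -/
instance matrixMeasurableSpace (n : ℕ) : MeasurableSpace (Matrix (Fin n) (Fin n) ℤ) := ⊤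

/-- The law of `Mₙ`: the uniform probability measure on symmetric `n × n` sign matrices. -/
def symmSignLaw (n : ℕ) : Measure (Matrix (Fin n) (Fin n) ℤ) :=
  uniformOn (symmSignMatrices n)

/-- The number of rows of the integer matrix `M` that are orthogonal over `R` to `a`. -/
def orthRows {R : Type*} [Ring R] {n : ℕ} (M : Matrix (Fin n) (Fin n) ℤ) (a : Fin n → R) : ℕ :=
  {i : Fin n | ∑ j, (M i j : R) * a j = 0}.ncard

/-- The event that every nonzero vector over `R` which is orthogonal to at least `(1 - β) n` rows
of the matrix has `μ`-atom probability at most `α`, for all `0 ≤ μ ≤ 1 / 2`. -/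
def orthEvent (R : Type*) [Ring R] (α β : ℝ) (n : ℕ) : Set (Matrix (Fin n) (Fin n) ℤ) :=
  {M | ∀ a : Fin n → R, a ≠ 0 → (1 - β) * (n : ℝ) ≤ (orthRows M a : ℝ) →
    ∀ μ : ℝ, 0 ≤ μ → μ ≤ 1 / 2 → atomProb μ a ≤ α}

/-- `α(n) = 2 ^ (-n^{1/4} √(log n) / 64)`. -/
def alphaParam (n : ℕ) : ℝ :=
  (2 : ℝ) ^ (-((n : ℝ) ^ (1 / 4 : ℝ) * √(Real.log n)) / 64)

/-- `β(n) = n^{-3/4} √(log n) / 128`. -/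
def betaParam (n : ℕ) : ℝ :=
  (n : ℝ) ^ (-(3 / 4) : ℝ) * √(Real.log n) / 128

/-- `2 ^ (n^{1/4} √(log n) / 32)`, the size of the prime. -/
def primeSize (n : ℕ) : ℝ :=
  (2 : ℝ) ^ ((n : ℝ) ^ (1 / 4 : ℝ) * √(Real.log n) / 32)

end

/-! Write L = n^{1/4}√(log n), so that α = 2^{-L/64}, βn = L/128 and p is between 2^{L/32} and twice
that. A bad vector is orthogonal to all rows in some T missing at most b = ⌊L/128⌋ of them. The
proof is a union bound over T and over vectors, and the difficulty is the number of vectors, up to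
p^n.

Rows: if J is disjoint from T, the entries in T × J are independent despite the symmetry. Hence the
rows in T are all orthogonal to a with probability at most `expSum (trunc J a) ^ #T`
(`symmSignLaw_rows_le`). The same `expSum` bounds all the lazy atom probabilities
(`atomProb_le_expSum`).

Halász: by Cauchy–Davenport on the level sets of the energy, `expSum` is, up to small errors, at
most 2^{-t} times the probability that a sparse random signed sum of the coordinates vanishes
(`expSum_le_zeroProb`). If an atom exceeds α, the errors are absorbed. With q the least probability
of a nontrivial relation on s support coordinates, this gives q ≥ α, and a cost of at most 2q/2^t
per usable row.

Counting: a nontrivial relation determines one coordinate from the others, so the sum of q^{|I|-s}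
over vectors with support I is at most p^s (`sum_minRelationProb_pow_le`). The factors q thus pay
for the vectors. What remains is p^s, about 2^{n/32}, times 2^n supports, and (2/2^t)^n beats both.
Vectors with support at most s are so few that a rate of 9/10 per row suffices. -/

open scoped Pointwise
open Finset

/-! ### Fourier bounds for atom probabilities over `ZMod p`. -/

section Fourier

variable {p : ℕ} [Fact p.Prime]

/-- `sin² (π x / p)`, a quarter of the squared distance from `1` to the `p`-th root of unity
indexed by `x`. -/
noncomputable def chordSq (x : ZMod p) : ℝ := (1 - (ZMod.stdAddChar x).re) / 2

lemma re_stdAddChar_sq_add_im_sq (x : ZMod p) :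
    (ZMod.stdAddChar x).re ^ 2 + (ZMod.stdAddChar x).im ^ 2 = 1 := by
  have h := AddChar.norm_apply (ZMod.stdAddChar (N := p)) x
  have h2 := Complex.normSq_eq_norm_sq (ZMod.stdAddChar x)
  rw [h, Complex.normSq_apply] at h2
  linarith

lemma re_stdAddChar_neg (x : ZMod p) :
    (ZMod.stdAddChar (-x)).re = (ZMod.stdAddChar x).re := by
  rw [AddChar.map_neg_eq_conj, Complex.conj_re]

lemma stdAddChar_add_neg (x : ZMod p) :
    ZMod.stdAddChar x + ZMod.stdAddChar (-x) = (2 * (ZMod.stdAddChar x).re : ℝ) := by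
  rw [AddChar.map_neg_eq_conj, Complex.add_conj]

lemma abs_re_stdAddChar_le (x : ZMod p) : |(ZMod.stdAddChar x).re| ≤ 1 := by
  have h := AddChar.norm_apply (ZMod.stdAddChar (N := p)) x
  exact h ▸ Complex.abs_re_le_norm _

lemma chordSq_nonneg (x : ZMod p) : 0 ≤ chordSq x := by
  have := (abs_le.1 (abs_re_stdAddChar_le x)).2
  unfold chordSq; linarith

lemma chordSq_le_one (x : ZMod p) : chordSq x ≤ 1 := by
  have := (abs_le.1 (abs_re_stdAddChar_le x)).1
  unfold chordSq; linarith

@[simp] lemma chordSq_zero : chordSq (0 : ZMod p) = 0 := by simp [chordSq]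

lemma chordSq_neg (x : ZMod p) : chordSq (-x) = chordSq x := by
  simp [chordSq, re_stdAddChar_neg]

/-- Triangle inequality for chords, |1 - zw| ≤ |1 - z| + |1 - w| on the unit circle, squared with (u
+ v)² ≤ 2u² + 2v². -/
lemma chordSq_add_le (x y : ZMod p) : chordSq (x + y) ≤ 2 * chordSq x + 2 * chordSq y := by
  have hx := re_stdAddChar_sq_add_im_sq x
  have hy := re_stdAddChar_sq_add_im_sq y
  have h : (ZMod.stdAddChar (x + y)).re = (ZMod.stdAddChar x).re * (ZMod.stdAddChar y).re
      - (ZMod.stdAddChar x).im * (ZMod.stdAddChar y).im := by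
    rw [AddChar.map_add_eq_mul, Complex.mul_re]
  unfold chordSq
  rw [h]
  nlinarith [sq_nonneg ((ZMod.stdAddChar x).re + (ZMod.stdAddChar y).re - 2),
    sq_nonneg ((ZMod.stdAddChar x).im - (ZMod.stdAddChar y).im)]

lemma chordSq_two_mul (x : ZMod p) : chordSq (2 * x) = 1 - (ZMod.stdAddChar x).re ^ 2 := by
  have hx := re_stdAddChar_sq_add_im_sq x
  have h : (ZMod.stdAddChar (2 * x)).re = (ZMod.stdAddChar x).re * (ZMod.stdAddChar x).re
      - (ZMod.stdAddChar x).im * (ZMod.stdAddChar x).im := by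
    rw [two_mul, AddChar.map_add_eq_mul, Complex.mul_re]
  unfold chordSq
  rw [h]
  linarith

lemma sum_stdAddChar_mul (z : ZMod p) :
    ∑ η : ZMod p, ZMod.stdAddChar (η * z) = if z = 0 then (p : ℂ) else 0 := by
  rw [AddChar.sum_mulShift z (ZMod.isPrimitive_stdAddChar p), ZMod.card]
  split_ifs <;> simp

lemma ite_eq_sum_stdAddChar (z c : ZMod p) :
    (if z = c then (1 : ℂ) else 0) =
      (1 / p) * ∑ η : ZMod p, ZMod.stdAddChar (-(c * η)) * ZMod.stdAddChar (η * z) := by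
  have hp : (p : ℂ) ≠ 0 := by exact_mod_cast (Fact.out : p.Prime).ne_zero
  have h : ∀ η : ZMod p, ZMod.stdAddChar (-(c * η)) * ZMod.stdAddChar (η * z)
      = ZMod.stdAddChar (η * (z - c)) := fun η => by
    rw [← AddChar.map_add_eq_mul]; congr 1; ring
  simp_rw [h, sum_stdAddChar_mul, sub_eq_zero]
  split_ifs <;> simp [hp]

lemma sum_chordSq_mul {z : ZMod p} (hz : z ≠ 0) : ∑ η : ZMod p, chordSq (z * η) = p / 2 := by
  have h := congrArg Complex.re (sum_stdAddChar_mul z)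
  rw [if_neg hz, Complex.re_sum, Complex.zero_re] at h
  simp_rw [chordSq, ← sum_div, sum_sub_distrib, mul_comm z, h]
  simp [ZMod.card]

/-- The left side is a convex combination of the cases μ = 0 and μ = 1/2, namely C and (1 + C)/2, so
it is enough to bound these two. This is where μ ≤ 1/2 is needed. -/
lemma abs_lazy_le {μ C : ℝ} (h0 : 0 ≤ μ) (h1 : μ ≤ 1 / 2) (hC : |C| ≤ 1) :
    |μ + (1 - μ) * C| ≤ Real.exp (-(1 - C ^ 2) / 4) := by
  obtain ⟨hl, hr⟩ := abs_le.1 hC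
  have e1 : |C| ≤ Real.exp (-(1 - C ^ 2) / 4) := by
    refine abs_le_of_sq_le_sq ?_ (Real.exp_pos _).le
    rw [sq (Real.exp _), ← Real.exp_add]
    have := Real.add_one_le_exp (-(1 - C ^ 2) / 4 + -(1 - C ^ 2) / 4)
    have h3 := Real.add_one_le_exp (-(1 - C ^ 2))
    refine le_trans ?_ (Real.exp_le_exp.2 (show -(1 - C ^ 2) ≤ _ by nlinarith))
    linarith
  have e2 : (1 + C) / 2 ≤ Real.exp (-(1 - C ^ 2) / 4) := by
    refine le_trans ?_ (Real.add_one_le_exp _)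
    nlinarith
  have e3 : μ + (1 - μ) * C = (1 - 2 * μ) * C + 2 * μ * ((1 + C) / 2) := by ring
  rw [e3]
  refine (abs_add_le _ _).trans ?_
  rw [abs_mul, abs_of_nonneg (by linarith : 0 ≤ 1 - 2 * μ),
    abs_of_nonneg (by nlinarith : 0 ≤ 2 * μ * ((1 + C) / 2))]
  nlinarith

variable {ι : Type*} [Fintype ι]

/-- The sum over the coordinates of `sin² (π aᵢ η / p)`. -/
noncomputable def energy (a : ι → ZMod p) (η : ZMod p) : ℝ := ∑ i, chordSq (a i * η)

/-- The average of `exp (-energy a / 4)`, a bound for the atom probabilities of `a`. -/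
noncomputable def expSum (a : ι → ZMod p) : ℝ := (1 / p) * ∑ η, Real.exp (-energy a η / 4)

/-- The restriction of the vector `a` to the coordinates in `J`. -/
def trunc [DecidableEq ι] (J : Finset ι) (a : ι → ZMod p) : ι → ZMod p :=
  fun i => if i ∈ J then a i else 0

lemma energy_nonneg (a : ι → ZMod p) (η : ZMod p) : 0 ≤ energy a η :=
  sum_nonneg fun _ _ => chordSq_nonneg _

lemma expSum_nonneg (a : ι → ZMod p) : 0 ≤ expSum a :=
  mul_nonneg (by positivity) (sum_nonneg fun _ _ => (Real.exp_pos _).le)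

lemma energy_trunc_le [DecidableEq ι] (J : Finset ι) (a : ι → ZMod p) (η : ZMod p) :
    energy (trunc J a) η ≤ energy a η := by
  refine sum_le_sum fun i _ => ?_
  by_cases h : i ∈ J <;> simp [trunc, h, chordSq_nonneg]

lemma expSum_le_trunc [DecidableEq ι] (J : Finset ι) (a : ι → ZMod p) :
    expSum a ≤ expSum (trunc J a) := by
  unfold expSum
  gcongr with η
  exact energy_trunc_le J a η

/-- The energy is even in each coordinate, so the signs of a fixed matrix row can be removed from
the row bound. -/
lemma energy_congr {a b : ι → ZMod p} (h : ∀ i, b i = a i ∨ b i = -a i) (η : ZMod p) :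
    energy b η = energy a η := by
  refine sum_congr rfl fun i _ => ?_
  rcases h i with h | h <;> simp [h, chordSq_neg]

lemma expSum_congr {a b : ι → ZMod p} (h : ∀ i, b i = a i ∨ b i = -a i) :
    expSum b = expSum a := by
  simp only [expSum, energy_congr h]

/-- The Fourier bound for the probability of an atom of a lazy walk with laziness at most `1/2`. -/
lemma prod_abs_lazy_le_expSum (hp : p ≠ 2) {μ : ℝ} (h0 : 0 ≤ μ) (h1 : μ ≤ 1 / 2)
    (a : ι → ZMod p) :
    (1 / p : ℝ) * ∑ η : ZMod p, ∏ i, |μ + (1 - μ) * (ZMod.stdAddChar (a i * η)).re|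
      ≤ expSum a := by
  have h2 : (2 : ZMod p) ≠ 0 := by
    intro h
    have : ((2 : ℕ) : ZMod p) = 0 := by exact_mod_cast h
    rw [ZMod.natCast_eq_zero_iff] at this
    exact hp ((Nat.prime_dvd_prime_iff_eq Fact.out Nat.prime_two).1 this)
  -- The bound for a single factor involves 1 - Re², which is `chordSq` at the doubled frequency. As
  -- p is odd, η ↦ 2η permutes the frequencies and removes the doubling.
  have hsub : ∑ η : ZMod p, Real.exp (-energy a η / 4)
      = ∑ η : ZMod p, Real.exp (-energy a (2 * η) / 4) :=
    (Equiv.sum_comp (Equiv.mulLeft₀ 2 h2) fun η => Real.exp (-energy a η / 4)).symm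
  unfold expSum
  rw [hsub]
  gcongr with η
  have : -energy a (2 * η) / 4 = ∑ i, -(1 - (ZMod.stdAddChar (a i * η)).re ^ 2) / 4 := by
    rw [energy, ← sum_neg_distrib, sum_div]
    refine sum_congr rfl fun i _ => ?_
    rw [← chordSq_two_mul]; congr 3; ring
  rw [this, Real.exp_sum]
  exact prod_le_prod (fun _ _ => abs_nonneg _) fun i _ => abs_lazy_le h0 h1 (abs_re_stdAddChar_le _)

lemma stdAddChar_sum (f : ι → ZMod p) :
    ZMod.stdAddChar (∑ i, f i) = ∏ i, ZMod.stdAddChar (f i) := by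
  classical
  induction (univ : Finset ι) using Finset.induction_on with
  | empty => simp
  | insert i s hi h => rw [sum_insert hi, prod_insert hi, AddChar.map_add_eq_mul, h]

/-- Fourier inversion for the law of a random linear combination with independent coefficients. -/
lemma sum_weight_ite [DecidableEq ι] {V : Type*} [Fintype V] (w : V → ℝ) (v : V → ZMod p)
    (b : ι → ZMod p) (c : ZMod p) :
    ((∑ y : ι → V, (∏ i, w (y i)) * (if ∑ i, v (y i) * b i = c then 1 else 0) : ℝ) : ℂ) =
      (1 / p) * ∑ η : ZMod p, ZMod.stdAddChar (-(c * η)) *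
        ∏ i, ∑ u, (w u : ℂ) * ZMod.stdAddChar (v u * (b i * η)) := by
  simp_rw [Fintype.prod_sum]
  push_cast
  simp only [apply_ite (Complex.ofReal), Complex.ofReal_one, Complex.ofReal_zero]
  simp_rw [ite_eq_sum_stdAddChar, mul_sum]
  rw [sum_comm]
  refine sum_congr rfl fun η _ => sum_congr rfl fun y _ => ?_
  rw [prod_mul_distrib, ← stdAddChar_sum]
  have : ∑ i, η * (v (y i) * b i) = ∑ i, v (y i) * (b i * η) :=
    sum_congr rfl fun i _ => by ring
  rw [this]
  ring

lemma sum_sign_ite_le [DecidableEq ι] (hp : p ≠ 2) (b : ι → ZMod p) (c : ZMod p) :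
    (∑ y : ι → ℤˣ, (∏ _i : ι, (1 / 2 : ℝ)) *
      (if ∑ i, ((y i : ℤ) : ZMod p) * b i = c then 1 else 0)) ≤ expSum b := by
  refine le_trans ?_ (prod_abs_lazy_le_expSum hp le_rfl (by norm_num) b)
  have h := sum_weight_ite (fun _ : ℤˣ => (1 / 2 : ℝ)) (fun u => ((u : ℤ) : ZMod p)) b c
  refine (le_abs_self _).trans ?_
  rw [← Real.norm_eq_abs, ← Complex.norm_real, h, norm_mul]
  refine mul_le_mul (by simp) ((norm_sum_le _ _).trans (sum_le_sum fun η _ => ?_))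
    (norm_nonneg _) (by positivity)
  rw [norm_mul, AddChar.norm_apply, one_mul, norm_prod]
  refine prod_le_prod (fun _ _ => norm_nonneg _) fun i _ => le_of_eq ?_
  have : ∑ u : ℤˣ, ((1 / 2 : ℝ) : ℂ) * ZMod.stdAddChar (((u : ℤ) : ZMod p) * (b i * η))
      = ((ZMod.stdAddChar (b i * η)).re : ℝ) := by
    have e : (univ : Finset ℤˣ) = {1, -1} := rfl
    rw [e, sum_insert (by decide), sum_singleton, ← mul_add]
    have := stdAddChar_add_neg (b i * η)
    simp only [Units.val_one, Int.cast_one, one_mul, Units.val_neg, Int.cast_neg, neg_mul]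
    rw [this]; push_cast; ring
  rw [this, Complex.norm_real, Real.norm_eq_abs]
  simp

instance (μ : ℝ) : IsFiniteMeasure (lazySign μ) := by
  have (r : ℝ) (z : ℤ) : IsFiniteMeasure (ENNReal.ofReal r • Measure.dirac z) :=
    Measure.smul_finite _ ENNReal.ofReal_ne_top
  unfold lazySign; infer_instance

lemma isProbabilityMeasure_lazySign {μ : ℝ} (h0 : 0 ≤ μ) (h1 : μ ≤ 1) :
    IsProbabilityMeasure (lazySign μ) := by
  constructor
  have h2 : 0 ≤ (1 - μ) / 2 := by linarith
  simp only [lazySign, Measure.add_apply, Measure.smul_apply, measure_univ, smul_eq_mul, mul_one]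
  rw [← ENNReal.ofReal_add h0 h2, ← ENNReal.ofReal_add (by linarith) h2,
    ← ENNReal.ofReal_one]
  congr 1; ring

lemma integral_lazySign {μ : ℝ} (h0 : 0 ≤ μ) (h1 : μ ≤ 1) (f : ℤ → ℂ) :
    ∫ x, f x ∂(lazySign μ) = μ * f 0 + (1 - μ) / 2 * (f 1 + f (-1)) := by
  have hi : ∀ (z : ℤ) (r : ℝ), Integrable f (ENNReal.ofReal r • Measure.dirac z) := fun z r =>
    (integrable_dirac (by simp)).smul_measure ENNReal.ofReal_ne_top
  rw [lazySign, integral_add_measure ((hi _ _).add_measure (hi _ _)) (hi _ _),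
    integral_add_measure (hi _ _) (hi _ _)]
  simp only [integral_smul_measure, integral_dirac]
  rw [ENNReal.toReal_ofReal h0, ENNReal.toReal_ofReal (by linarith)]
  simp only [Complex.real_smul]
  push_cast; ring

lemma atomProb_le_expSum (hp : p ≠ 2) {n : ℕ} {μ : ℝ} (h0 : 0 ≤ μ) (h1 : μ ≤ 1 / 2)
    (a : Fin n → ZMod p) : atomProb μ a ≤ expSum a := by
  refine ciSup_le fun c => (le_trans ?_ (prod_abs_lazy_le_expSum hp h0 h1 a))
  have := isProbabilityMeasure_lazySign h0 (by linarith)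
  set P := Measure.pi fun _ : Fin n => lazySign μ with hP
  set S : Set (Fin n → ℤ) := {x | ∑ i, a i * (x i : ZMod p) = c} with hS
  have hint : ∀ η : ZMod p, Integrable (fun x : Fin n → ℤ => ZMod.stdAddChar (-(c * η)) *
      ∏ i, ZMod.stdAddChar ((x i : ZMod p) * (a i * η))) P := fun η => by
    refine Integrable.of_bound (C := 1) (Measurable.of_discrete.aestronglyMeasurable) ?_
    filter_upwards with x
    simp [AddChar.norm_apply]
  have hmain : (P.real S : ℂ) = (1 / p) * ∑ η : ZMod p, ZMod.stdAddChar (-(c * η)) *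
      ∏ i, ((μ + (1 - μ) * (ZMod.stdAddChar (a i * η)).re : ℝ) : ℂ) := by
    have h1' : (P.real S : ℂ) = ∫ x, S.indicator (fun _ => (1 : ℂ)) x ∂P := by
      rw [integral_indicator_const _ (MeasurableSet.of_discrete)]; simp
    have h2 : ∀ x, S.indicator (fun _ => (1 : ℂ)) x = (1 / p) * ∑ η : ZMod p,
        ZMod.stdAddChar (-(c * η)) * ∏ i, ZMod.stdAddChar ((x i : ZMod p) * (a i * η)) := by
      intro x
      have e : S.indicator (fun _ => (1 : ℂ)) x
          = if ∑ i, a i * (x i : ZMod p) = c then (1 : ℂ) else 0 := by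
        simp [Set.indicator_apply, hS]
      rw [e, ite_eq_sum_stdAddChar]
      refine congrArg _ (sum_congr rfl fun η _ => ?_)
      rw [← stdAddChar_sum, mul_sum]
      congr 2
      exact sum_congr rfl fun i _ => by ring
    rw [h1']
    simp_rw [h2]
    rw [integral_const_mul, integral_finsetSum _ fun η _ => hint η]
    refine congrArg _ (sum_congr rfl fun η _ => ?_)
    rw [integral_const_mul, hP, integral_fintype_prod_eq_prod
      (f := fun i (x : ℤ) => ZMod.stdAddChar ((x : ZMod p) * (a i * η)))]
    refine congrArg _ (prod_congr rfl fun i _ => ?_)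
    rw [integral_lazySign h0 (by linarith)]
    have := stdAddChar_add_neg (a i * η)
    simp only [Int.cast_zero, zero_mul, AddChar.map_zero_eq_one, Int.cast_one, one_mul,
      Int.cast_neg, neg_mul]
    rw [this]; push_cast; ring
  rw [← abs_of_nonneg (measureReal_nonneg (μ := P) (s := S)), ← Real.norm_eq_abs,
    ← Complex.norm_real, hmain, norm_mul]
  refine mul_le_mul (by simp) ((norm_sum_le _ _).trans (sum_le_sum fun η _ => ?_))
    (norm_nonneg _) (by positivity)
  rw [norm_mul, AddChar.norm_apply, one_mul, norm_prod]
  exact prod_le_prod (fun _ _ => norm_nonneg _) fun i _ => by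
    rw [Complex.norm_real, Real.norm_eq_abs]

end Fourier

/-! ### Halász-type comparison with a sparse random walk. -/

section Halasz

/-- Comparison of two finite sums through their level sets. -/
lemma sum_le_of_card_level_le {α : Type*} [Fintype α] {f h : α → ℝ} {A B c u₀ : ℝ}
    (hf0 : ∀ x, 0 ≤ f x) (hf1 : ∀ x, f x ≤ 1) (hh0 : ∀ x, 0 ≤ h x) (hh1 : ∀ x, h x ≤ 1)
    (hu0 : 0 ≤ u₀) (hu1 : u₀ ≤ 1)
    (H : ∀ u : ℝ, 0 < u → u ≤ 1 → (#{x | u ≤ f x} : ℝ) ≤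
      A * (if u ≤ u₀ then 1 else 0) + B + c * #{x | u ≤ h x}) :
    ∑ x, f x ≤ A * u₀ + B + c * ∑ x, h x := by
  -- Layer-cake formula: y is the integral over u in (0, 1] of the indicator of u ≤ y.
  set φ : ℝ → ℝ → ℝ := fun y u => if u ≤ y then 1 else 0 with hφ
  have hφi : ∀ y, φ y = (Set.Iic y).indicator fun _ => (1 : ℝ) := fun y => by
    ext u; simp [hφ, Set.indicator_apply]
  have hint : ∀ y, IntegrableOn (φ y) (Set.Ioc 0 1) volume := fun y => by
    rw [hφi]; exact (integrable_const _).indicator measurableSet_Iic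
  have hval : ∀ y, 0 ≤ y → y ≤ 1 → ∫ u in Set.Ioc (0 : ℝ) 1, φ y u = y := fun y hy0 hy1 => by
    rw [hφi, integral_indicator_const _ measurableSet_Iic, measureReal_restrict_apply
      measurableSet_Iic, Set.inter_comm, Set.Ioc_inter_Iic, min_eq_right hy1]
    simp [hy0]
  have hcard : ∀ (g : α → ℝ) (u : ℝ), (#{x | u ≤ g x} : ℝ) = ∑ x, φ (g x) u := fun g u => by
    simp [hφ]
  have hsum : ∀ g : α → ℝ, (∀ x, 0 ≤ g x) → (∀ x, g x ≤ 1) →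
      ∫ u in Set.Ioc (0 : ℝ) 1, ∑ x, φ (g x) u = ∑ x, g x := fun g h0 h1 => by
    rw [integral_finsetSum _ fun x _ => hint _]
    exact sum_congr rfl fun x _ => hval _ (h0 x) (h1 x)
  have hints : ∀ g : α → ℝ, IntegrableOn (fun u => ∑ x, φ (g x) u) (Set.Ioc 0 1) volume :=
    fun g => integrable_finsetSum _ fun x _ => hint _
  calc ∑ x, f x = ∫ u in Set.Ioc (0 : ℝ) 1, ∑ x, φ (f x) u := (hsum f hf0 hf1).symm
    _ ≤ ∫ u in Set.Ioc (0 : ℝ) 1, (A * φ u₀ u + B + c * ∑ x, φ (h x) u) := by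
        refine setIntegral_mono_on (hints f) ((((hint u₀).const_mul A).add
          (integrable_const B)).add ((hints h).const_mul c)) measurableSet_Ioc fun u hu => ?_
        rw [← hcard, ← hcard]
        exact H u hu.1 hu.2
    _ = A * u₀ + B + c * ∑ x, h x := by
        have e1 := integral_add (((hint u₀).const_mul A).add (integrable_const B))
          ((hints h).const_mul c)
        have e2 := integral_add ((hint u₀).const_mul A) (integrable_const B)
        simp only [Pi.add_apply] at e1 e2
        rw [e1, e2, integral_const_mul, integral_const_mul, hsum h hh0 hh1, hval _ hu0 hu1]
        simp

variable {p : ℕ} [Fact p.Prime] {ι : Type*} [Fintype ι]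

lemma sum_energy (a : ι → ZMod p) : ∑ η, energy a η = #{i | a i ≠ 0} * (p / 2 : ℝ) := by
  unfold energy
  rw [sum_comm, ← sum_filter_add_sum_filter_not univ (fun i => a i ≠ 0),
    sum_congr rfl fun i hi => sum_chordSq_mul (mem_filter.1 hi).2,
    sum_eq_zero (s := univ.filter fun i => ¬ a i ≠ 0)]
  · simp
  · intro i hi
    have : a i = 0 := by simpa using hi
    simp [this]

lemma energy_add_le (a : ι → ZMod p) (x y : ZMod p) :
    energy a (x + y) ≤ 2 * energy a x + 2 * energy a y := by
  unfold energy
  rw [mul_sum, mul_sum, ← sum_add_distrib]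
  exact sum_le_sum fun i _ => by rw [mul_add]; exact chordSq_add_le _ _

/-- The frequencies at which the energy of `a` is at most `r`. -/
noncomputable def lowEnergy (a : ι → ZMod p) (r : ℝ) : Finset (ZMod p) := {η | energy a η ≤ r}

lemma lowEnergy_mono (a : ι → ZMod p) {r r' : ℝ} (h : r ≤ r') :
    lowEnergy a r ⊆ lowEnergy a r' := fun η hη => by
  simp only [lowEnergy, mem_filter, mem_univ, true_and] at *; linarith

/-- The mean energy over all frequencies is half the support size, so some frequency exceeds any
smaller level. This keeps Cauchy–Davenport away from its trivial case, where the sumset may be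
everything. -/
lemma card_lowEnergy_lt (a : ι → ZMod p) {r : ℝ} (hr : r < #{i | a i ≠ 0} / 2) :
    #(lowEnergy a r) < p := by
  refine ((card_lt_iff_ne_univ _).2 fun h => ?_).trans_eq (ZMod.card p)
  have h1 : ∑ η, energy a η ≤ ∑ _η : ZMod p, r := sum_le_sum fun η _ => by
    have : η ∈ lowEnergy a r := h ▸ mem_univ η
    simpa [lowEnergy] using this
  rw [sum_energy, sum_const, card_univ, ZMod.card, nsmul_eq_mul] at h1
  have hp : (0 : ℝ) < p := by exact_mod_cast (Fact.out : p.Prime).pos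
  nlinarith

/-- Energy behaves like a squared norm, so the sumset of the level set at r lies in the level set at
4r. Cauchy–Davenport gives that sumset at least 2k - 1 elements when the first set has k. -/
lemma two_mul_card_lowEnergy_le (a : ι → ZMod p) {r : ℝ} (hr : 0 ≤ r)
    (h : #(lowEnergy a (4 * r)) < p) : 2 * #(lowEnergy a r) ≤ #(lowEnergy a (4 * r)) + 1 := by
  have h0 : (lowEnergy a r).Nonempty := ⟨0, by
    simp only [lowEnergy, mem_filter, mem_univ, true_and]
    simpa [energy] using hr⟩
  have hsub : lowEnergy a r + lowEnergy a r ⊆ lowEnergy a (4 * r) := by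
    intro z hz
    obtain ⟨x, hx, y, hy, rfl⟩ := mem_add.1 hz
    simp only [lowEnergy, mem_filter, mem_univ, true_and] at *
    linarith [energy_add_le a x y]
  have hcd := (ZMod.cauchy_davenport Fact.out h0 h0).trans (card_le_card hsub)
  omega

lemma card_lowEnergy_le (a : ι → ZMod p) (t : ℕ) {r : ℝ} (hr : 0 ≤ r)
    (h : #(lowEnergy a (4 ^ t * r)) < p) :
    (#(lowEnergy a r) : ℝ) ≤ 1 + (1 / 2 ^ t) * #(lowEnergy a (4 ^ t * r)) := by
  -- Subtracting 1 from the cardinalities turns the recursion into exact doubling.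
  have key : (2 : ℝ) ^ t * (#(lowEnergy a r) - 1) ≤ #(lowEnergy a (4 ^ t * r)) - 1 := by
    induction t with
    | zero => simp
    | succ t ih =>
      have e : (4 : ℝ) ^ (t + 1) * r = 4 * (4 ^ t * r) := by ring
      rw [e] at h ⊢
      have hr' : 0 ≤ 4 ^ t * r := by positivity
      have hle : #(lowEnergy a (4 ^ t * r)) < p :=
        (card_le_card (lowEnergy_mono a (by linarith))).trans_lt h
      have h2 := two_mul_card_lowEnergy_le a (by positivity : 0 ≤ 4 ^ t * r) h
      have h3 : (2 : ℝ) * #(lowEnergy a (4 ^ t * r)) ≤ #(lowEnergy a (4 * (4 ^ t * r))) + 1 := by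
        exact_mod_cast h2
      have := ih hle
      rw [pow_succ]
      linarith
  have hm : (0 : ℝ) < 2 ^ t := by positivity
  have : (#(lowEnergy a r) : ℝ) - 1 ≤ (#(lowEnergy a (4 ^ t * r)) - 1) / 2 ^ t := by
    rw [le_div_iff₀ hm]; linarith
  have h4 : ((#(lowEnergy a (4 ^ t * r)) : ℝ) - 1) / 2 ^ t
      ≤ #(lowEnergy a (4 ^ t * r)) / 2 ^ t := by gcongr; linarith
  rw [one_div, inv_mul_eq_div]
  linarith

/-- A sharp random walk bound in terms of a sparse one, in the style of Halász. -/
lemma sum_exp_energy_le (a : ι → ZMod p) (t : ℕ) :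
    ∑ η, Real.exp (-energy a η / 4) ≤
      p * Real.exp (-(#{i | a i ≠ 0} : ℝ) / (8 * 4 ^ t)) + 1 +
        (1 / 2 ^ t) * ∑ η, Real.exp (-energy a η / (4 * 4 ^ t)) := by
  have hm : (0 : ℝ) < 4 ^ t := by positivity
  have hE := energy_nonneg a
  refine sum_le_of_card_level_le (fun _ => (Real.exp_pos _).le) (fun η => ?_)
    (fun _ => (Real.exp_pos _).le) (fun η => ?_) (Real.exp_pos _).le ?_ fun u hu0 hu1 => ?_
  · exact Real.exp_le_one_iff.2 (by linarith [hE η])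
  · exact Real.exp_le_one_iff.2 (div_nonpos_of_nonpos_of_nonneg (by linarith [hE η]) (by positivity))
  · exact Real.exp_le_one_iff.2 (div_nonpos_of_nonpos_of_nonneg (by simp) (by positivity))
  · have e1 : ({η | u ≤ Real.exp (-energy a η / 4)} : Finset (ZMod p))
        = lowEnergy a (-4 * Real.log u) := by
      ext η
      simp only [lowEnergy, mem_filter, mem_univ, true_and, ← Real.log_le_iff_le_exp hu0]
      constructor <;> intro h <;> linarith
    have e2 : ({η | u ≤ Real.exp (-energy a η / (4 * 4 ^ t))} : Finset (ZMod p))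
        = lowEnergy a (4 ^ t * (-4 * Real.log u)) := by
      ext η
      simp only [lowEnergy, mem_filter, mem_univ, true_and, ← Real.log_le_iff_le_exp hu0]
      rw [le_div_iff₀ (by positivity)]
      constructor <;> intro h <;> linarith
    rw [e1, e2]
    -- Below the threshold u₀ the trivial bound p is used. Above it, 4^t · (-4 log u) is less than
    -- half the support size, so the larger level set is proper and the doubling argument applies.
    split_ifs with hu
    · have h1 : (#(lowEnergy a (-4 * Real.log u)) : ℝ) ≤ p := by
        have := card_le_univ (lowEnergy a (-4 * Real.log u))
        rw [ZMod.card] at this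
        exact_mod_cast this
      have : (0 : ℝ) ≤ 1 / 2 ^ t * #(lowEnergy a (4 ^ t * (-4 * Real.log u))) := by positivity
      linarith
    · rw [mul_zero, zero_add]
      refine card_lowEnergy_le a t (by nlinarith [Real.log_nonpos hu0.le hu1])
        (card_lowEnergy_lt a ?_)
      rw [not_le, ← Real.lt_log_iff_exp_lt hu0, div_lt_iff₀ (by positivity)] at hu
      linarith

/-- The law on signs giving mass `1 - r` to `0` and mass `r / 2` to each of `1`, `-1`. -/
noncomputable def sparseWeight (r : ℝ) (u : SignType) : ℝ := if u = 0 then 1 - r else r / 2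

lemma sparseWeight_nonneg {r : ℝ} (h0 : 0 ≤ r) (h1 : r ≤ 1) (u : SignType) :
    0 ≤ sparseWeight r u := by
  unfold sparseWeight; split_ifs <;> linarith

lemma sum_signType {M : Type*} [AddCommMonoid M] (f : SignType → M) :
    ∑ u, f u = f 0 + (f 1 + f (-1)) := by
  have e : (univ : Finset SignType) = {0, 1, -1} := by decide
  rw [e, sum_insert (by decide), sum_insert (by decide), sum_singleton]

lemma sum_sparseWeight (r : ℝ) : ∑ u, sparseWeight r u = 1 := by
  rw [sum_signType]; simp [sparseWeight]

lemma sum_prod_sparseWeight [DecidableEq ι] (r : ℝ) :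
    ∑ x : ι → SignType, ∏ i, sparseWeight r (x i) = 1 := by
  rw [← Fintype.prod_sum fun (_ : ι) u => sparseWeight r u]
  simp [sum_sparseWeight]

/-- The probability that a sparse random signed sum of the coordinates of `a` vanishes. -/
noncomputable def zeroProb [DecidableEq ι] (r : ℝ) (a : ι → ZMod p) : ℝ :=
  ∑ x : ι → SignType, (∏ i, sparseWeight r (x i)) *
    (if ∑ i, (x i : ZMod p) * a i = 0 then 1 else 0)

lemma zeroProb_eq [DecidableEq ι] (r : ℝ) (a : ι → ZMod p) :
    zeroProb r a = (1 / p) * ∑ η : ZMod p, ∏ i, (1 - 2 * r * chordSq (a i * η)) := by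
  rw [← Complex.ofReal_inj, zeroProb,
    sum_weight_ite (sparseWeight r) (fun u : SignType => (u : ZMod p)) a 0]
  push_cast
  refine congrArg _ (sum_congr rfl fun η _ => ?_)
  rw [zero_mul, neg_zero, AddChar.map_zero_eq_one, one_mul]
  refine prod_congr rfl fun i _ => ?_
  rw [sum_signType]
  have := stdAddChar_add_neg (a i * η)
  simp only [sparseWeight, SignType.coe_zero, SignType.coe_one, SignType.coe_neg, zero_mul,
    one_mul, neg_mul, AddChar.map_zero_eq_one, if_true, chordSq]
  rw [if_neg (by decide), if_neg (by decide), ← mul_add, this]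
  push_cast; ring

lemma exp_le_one_sub {u : ℝ} (h0 : 0 ≤ u) (h1 : u ≤ 1 / 2) : Real.exp (-(2 * u)) ≤ 1 - u := by
  rw [Real.exp_neg]
  refine inv_le_of_inv_le₀ (by linarith) ?_
  refine le_trans ?_ (Real.add_one_le_exp _)
  rw [inv_le_iff_one_le_mul₀ (by linarith)]
  nlinarith

/-- The value r = 1/(16·4^t) is chosen so that exp(-2v) ≤ 1 - v, with v = 2r · `chordSq`, bounds
each slowed exponential by a Fourier factor of the sparse walk. All these factors are positive, so
no absolute values are needed and inversion gives a genuine probability. -/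
lemma expSum_le_zeroProb [DecidableEq ι] (a : ι → ZMod p) (t : ℕ) :
    expSum a ≤ Real.exp (-(#{i | a i ≠ 0} : ℝ) / (8 * 4 ^ t)) + 1 / p +
      zeroProb (1 / (16 * 4 ^ t)) a / 2 ^ t := by
  have hp : (0 : ℝ) < p := by exact_mod_cast (Fact.out : p.Prime).pos
  have h1 : (1 / p : ℝ) * ∑ η, Real.exp (-energy a η / (4 * 4 ^ t))
      ≤ zeroProb (1 / (16 * 4 ^ t)) a := by
    rw [zeroProb_eq]
    gcongr with η
    rw [energy, ← sum_neg_distrib, sum_div, Real.exp_sum]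
    refine prod_le_prod (fun _ _ => (Real.exp_pos _).le) fun i _ => ?_
    have h4 : (1 : ℝ) ≤ 4 ^ t := one_le_pow₀ (by norm_num)
    have h5 : 1 / (16 * 4 ^ t : ℝ) ≤ 1 / 16 := by
      rw [div_le_div_iff₀ (by positivity) (by norm_num)]; linarith
    have h6 : 0 < 1 / (16 * 4 ^ t : ℝ) := by positivity
    have := exp_le_one_sub (u := 2 * (1 / (16 * 4 ^ t)) * chordSq (a i * η))
      (mul_nonneg (by positivity) (chordSq_nonneg _))
      (by nlinarith [chordSq_le_one (a i * η), chordSq_nonneg (a i * η)])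
    refine le_trans (le_of_eq ?_) this
    congr 1
    field_simp
    ring
  calc expSum a ≤ (1 / p) * (p * Real.exp (-(#{i | a i ≠ 0} : ℝ) / (8 * 4 ^ t)) + 1 +
        (1 / 2 ^ t) * ∑ η, Real.exp (-energy a η / (4 * 4 ^ t))) := by
          unfold expSum; gcongr; exact sum_exp_energy_le a t
    _ = Real.exp (-(#{i | a i ≠ 0} : ℝ) / (8 * 4 ^ t)) + 1 / p +
      ((1 / p) * ∑ η, Real.exp (-energy a η / (4 * 4 ^ t))) / 2 ^ t := by field_simp
    _ ≤ _ := by gcongr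

/-- The probability that a sparse random signed sum of the coordinates of `a` in `J` vanishes
without being the empty sum. -/
noncomputable def relationProb [DecidableEq ι] (r : ℝ) (J : Finset ι) (a : ι → ZMod p) : ℝ :=
  ∑ x : ι → SignType, (∏ i, sparseWeight r (x i)) *
    (if ∑ i ∈ J, (x i : ZMod p) * a i = 0 ∧ ∃ j ∈ J, x j ≠ 0 then 1 else 0)

lemma relationProb_nonneg [DecidableEq ι] {r : ℝ} (h0 : 0 ≤ r) (h1 : r ≤ 1) (J : Finset ι)
    (a : ι → ZMod p) : 0 ≤ relationProb r J a :=
  sum_nonneg fun _ _ => mul_nonneg (prod_nonneg fun _ _ => sparseWeight_nonneg h0 h1 _)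
    (by split_ifs <;> norm_num)

lemma relationProb_le_one [DecidableEq ι] {r : ℝ} (h0 : 0 ≤ r) (h1 : r ≤ 1) (J : Finset ι)
    (a : ι → ZMod p) : relationProb r J a ≤ 1 := by
  rw [← sum_prod_sparseWeight (ι := ι) r]
  exact sum_le_sum fun _ _ => mul_le_of_le_one_right
    (prod_nonneg fun _ _ => sparseWeight_nonneg h0 h1 _) (by split_ifs <;> norm_num)

lemma relationProb_congr [DecidableEq ι] (r : ℝ) {J : Finset ι} {a b : ι → ZMod p}
    (h : ∀ j ∈ J, a j = b j) : relationProb r J a = relationProb r J b := by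
  unfold relationProb
  refine sum_congr rfl fun x _ => ?_
  rw [sum_congr rfl fun j hj => by rw [h j hj]]

lemma sum_trunc [DecidableEq ι] (J : Finset ι) (a : ι → ZMod p) (v : ι → ZMod p) :
    ∑ i, v i * trunc J a i = ∑ i ∈ J, v i * a i := by
  simp [trunc]

lemma sum_sparse_vanishing [DecidableEq ι] (r : ℝ) (J : Finset ι) :
    ∑ x : ι → SignType, (∏ i, sparseWeight r (x i)) * (if ∀ j ∈ J, x j = 0 then 1 else 0)
      = (1 - r) ^ #J := by
  have h : ∀ x : ι → SignType,
      (∏ i, sparseWeight r (x i)) * (if ∀ j ∈ J, x j = 0 then (1 : ℝ) else 0)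
      = ∏ i, sparseWeight r (x i) * (if i ∈ J → x i = 0 then 1 else 0) := fun x => by
    rw [prod_mul_distrib]
    refine congrArg _ ?_
    split_ifs with hx
    · exact (prod_eq_one fun i _ => if_pos (hx i)).symm
    · push Not at hx
      obtain ⟨j, hj, hxj⟩ := hx
      exact (prod_eq_zero (mem_univ j) (by simp [hj, hxj])).symm
  simp_rw [h]
  rw [← Fintype.prod_sum fun (i : ι) u => sparseWeight r u * (if i ∈ J → u = 0 then 1 else 0),
    ← prod_const, ← prod_subset (subset_univ J)]
  · refine prod_congr rfl fun i hi => ?_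
    rw [sum_signType]
    simp [hi, sparseWeight]
  · intro i _ hi
    simp [hi, sum_sparseWeight]

/-- A vanishing sum either involves a nonzero coefficient on J or is empty. The empty sum carries no
information about a, so it is split off. -/
lemma zeroProb_trunc_le [DecidableEq ι] {r : ℝ} (h0 : 0 ≤ r) (h1 : r ≤ 1) (J : Finset ι)
    (a : ι → ZMod p) : zeroProb r (trunc J a) ≤ relationProb r J a + (1 - r) ^ #J := by
  rw [← sum_sparse_vanishing, zeroProb, relationProb, ← sum_add_distrib]
  refine sum_le_sum fun x _ => ?_
  rw [← mul_add, sum_trunc]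
  refine mul_le_mul_of_nonneg_left ?_ (prod_nonneg fun _ _ => sparseWeight_nonneg h0 h1 _)
  by_cases hx : ∃ j ∈ J, x j ≠ 0
  · have : 0 ≤ (if ∀ j ∈ J, x j = 0 then (1 : ℝ) else 0) := by split_ifs <;> norm_num
    simp only [hx, and_true]
    linarith
  · have hx' : ∀ j ∈ J, x j = 0 := by simpa using hx
    rw [if_pos hx']
    split_ifs <;> norm_num

end Halasz

/-! ### Weighted counting of vectors with many linear relations. -/

section Counting

variable {p : ℕ} [Fact p.Prime] {ι : Type*} [Fintype ι] [DecidableEq ι]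

/-- The vectors over `ZMod p` whose support is exactly `I`. -/
def vectorsWithSupport (p : ℕ) [Fact p.Prime] (I : Finset ι) : Finset (ι → ZMod p) :=
  {a | ∀ i, a i ≠ 0 ↔ i ∈ I}

lemma mem_vectorsWithSupport {I : Finset ι} {a : ι → ZMod p} :
    a ∈ vectorsWithSupport p I ↔ ∀ i, a i ≠ 0 ↔ i ∈ I := by
  simp [vectorsWithSupport]

lemma card_vectorsWithSupport_le (I : Finset ι) : #(vectorsWithSupport p I) ≤ p ^ #I := by
  have h : vectorsWithSupport p I ⊆
      Fintype.piFinset fun i => if i ∈ I then (univ : Finset (ZMod p)) else {0} := by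
    intro a ha
    rw [mem_vectorsWithSupport] at ha
    rw [Fintype.mem_piFinset]
    intro i
    by_cases hi : i ∈ I
    · simp [hi]
    · simpa [hi] using (ha i).not.2 hi
  refine (card_le_card h).trans_eq ?_
  rw [Fintype.card_piFinset, ← prod_const, ← prod_subset (subset_univ I)]
  · exact prod_congr rfl fun i hi => by simp [hi, ZMod.card]
  · intro i _ hi; simp [hi]

/-- The least relation probability of `a` on an `s`-subset of `I`. -/
noncomputable def minRelationProb (r : ℝ) (s : ℕ) (I : Finset ι) (a : ι → ZMod p) : ℝ :=
  ⨅ J : {J : Finset ι // J ⊆ I ∧ #J = s}, relationProb r J a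

lemma minRelationProb_le (r : ℝ) {s : ℕ} {I J : Finset ι} (hJ : J ⊆ I) (hs : #J = s)
    (a : ι → ZMod p) : minRelationProb r s I a ≤ relationProb r J a :=
  ciInf_le (Set.finite_range _).bddBelow (⟨J, hJ, hs⟩ : {J : Finset ι // J ⊆ I ∧ #J = s})

lemma exists_minRelationProb_eq (r : ℝ) {s : ℕ} {I : Finset ι} (hs : s ≤ #I) (a : ι → ZMod p) :
    ∃ J ⊆ I, #J = s ∧ relationProb r J a = minRelationProb r s I a := by
  obtain ⟨J₀, h₀, h₁⟩ := exists_subset_card_eq hs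
  have : Nonempty {J : Finset ι // J ⊆ I ∧ #J = s} := ⟨⟨J₀, h₀, h₁⟩⟩
  obtain ⟨J, hJ⟩ := exists_eq_ciInf_of_finite
    (f := fun J : {J : Finset ι // J ⊆ I ∧ #J = s} => relationProb r J a)
  exact ⟨J, J.2.1, J.2.2, hJ⟩

lemma minRelationProb_nonneg {r : ℝ} (h0 : 0 ≤ r) (h1 : r ≤ 1) (s : ℕ) (I : Finset ι)
    (a : ι → ZMod p) : 0 ≤ minRelationProb r s I a :=
  Real.iInf_nonneg fun _ => relationProb_nonneg h0 h1 _ _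

/-- Every s-subset avoiding j competes in the minimum over I and does not see the coordinate j.
Deleting j can therefore only raise the minimum, which is the direction the induction needs. -/
lemma minRelationProb_le_erase (r : ℝ) {s : ℕ} {I : Finset ι} {j : ι} (hs : s ≤ #(I.erase j))
    (a : ι → ZMod p) :
    minRelationProb r s I a ≤ minRelationProb r s (I.erase j) (Function.update a j 0) := by
  obtain ⟨J, hJ, hJs, h⟩ := exists_minRelationProb_eq r hs (Function.update a j 0)
  rw [← h]
  refine (minRelationProb_le r (hJ.trans (erase_subset _ _)) hJs a).trans_eq ?_
  refine relationProb_congr r fun i hi => ?_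
  rw [Function.update_of_ne (ne_of_mem_erase (hJ hi))]

lemma signType_cast_ne_zero {u : SignType} (hu : u ≠ 0) : (u : ZMod p) ≠ 0 := by
  cases u with
  | zero => exact absurd rfl hu
  | neg => exact neg_ne_zero.2 one_ne_zero
  | pos => exact one_ne_zero

/-- The weighted inverse Littlewood–Offord count: vectors all of whose restrictions to `s`
coordinates have many short linear relations are rare. -/
lemma sum_minRelationProb_pow_le {r : ℝ} (h0 : 0 ≤ r) (h1 : r ≤ 1) (s k : ℕ) :
    ∀ I : Finset ι, #I = s + k →
      ∑ a ∈ vectorsWithSupport p I, minRelationProb r s I a ^ k ≤ (p : ℝ) ^ s := by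
  induction k with
  | zero =>
    intro I hI
    have := card_vectorsWithSupport_le (p := p) I
    rw [hI] at this
    simpa using (by exact_mod_cast this : (#(vectorsWithSupport p I) : ℝ) ≤ (p : ℝ) ^ (s + 0))
  | succ k ih =>
    intro I hI
    obtain ⟨J, hJ, hJs⟩ := exists_subset_card_eq (show s ≤ #I by omega)
    have hq := fun I => minRelationProb_nonneg (p := p) (ι := ι) h0 h1 s I
    -- One of the k + 1 factors is expanded as a sum over sign patterns x. For fixed x the other k
    -- factors go to the induction hypothesis on I without one index.
    have step : ∀ x : ι → SignType,
        ∑ a ∈ vectorsWithSupport p I,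
          (if ∑ i ∈ J, (x i : ZMod p) * a i = 0 ∧ ∃ j ∈ J, x j ≠ 0 then 1 else 0) *
            minRelationProb r s I a ^ k ≤ (p : ℝ) ^ s := by
      intro x
      by_cases hx : ∃ j ∈ J, x j ≠ 0
      swap
      · simp [hx]
      obtain ⟨j, hj, hxj⟩ := id hx
      simp only [hx, and_true, ite_mul, one_mul, zero_mul]
      rw [← sum_filter]
      have hcard : #(I.erase j) = s + k := by rw [card_erase_of_mem (hJ hj)]; omega
      refine le_trans ?_ (ih (I.erase j) hcard)
      set A := (vectorsWithSupport p I).filter fun a => ∑ i ∈ J, (x i : ZMod p) * a i = 0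
      -- As x j ≠ 0, the relation recovers a j from the other coordinates, so erasing j loses
      -- nothing.
      have hinj : Set.InjOn (fun a : ι → ZMod p => Function.update a j 0) A := by
        intro a ha b hb hab
        have hne : ∀ i, i ≠ j → a i = b i := fun i hi => by
          have := congrFun hab i
          simpa [Function.update_of_ne hi] using this
        have ha' := (mem_filter.1 (mem_coe.1 ha)).2
        have hb' := (mem_filter.1 (mem_coe.1 hb)).2
        rw [← add_sum_erase _ _ hj] at ha' hb'
        rw [sum_congr rfl fun i hi => by rw [hne i (ne_of_mem_erase hi)]] at ha'
        have hj' : a j = b j :=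
          mul_left_cancel₀ (signType_cast_ne_zero hxj) (add_right_cancel (ha'.trans hb'.symm))
        funext i
        by_cases hi : i = j
        · rw [hi, hj']
        · exact hne i hi
      calc ∑ a ∈ A, minRelationProb r s I a ^ k
          ≤ ∑ a ∈ A, minRelationProb r s (I.erase j) (Function.update a j 0) ^ k :=
            sum_le_sum fun a _ => pow_le_pow_left₀ (hq I a)
              (minRelationProb_le_erase r (by omega) a) k
        _ = ∑ b ∈ A.image fun a => Function.update a j 0,
              minRelationProb r s (I.erase j) b ^ k := (sum_image (f := fun b => minRelationProb r s (I.erase j) b ^ k) hinj).symm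
        _ ≤ _ := by
            refine sum_le_sum_of_subset_of_nonneg ?_ fun b _ _ => pow_nonneg (hq _ b) k
            intro b hb
            obtain ⟨a, ha, rfl⟩ := mem_image.1 hb
            have ha' := mem_vectorsWithSupport.1 (mem_filter.1 ha).1
            rw [mem_vectorsWithSupport]
            intro i
            by_cases hi : i = j
            · simp [hi]
            · simp [hi, ha' i]
    calc ∑ a ∈ vectorsWithSupport p I, minRelationProb r s I a ^ (k + 1)
        ≤ ∑ a ∈ vectorsWithSupport p I, relationProb r J a * minRelationProb r s I a ^ k := by
          refine sum_le_sum fun a _ => ?_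
          rw [pow_succ']
          exact mul_le_mul_of_nonneg_right (minRelationProb_le r hJ hJs a) (pow_nonneg (hq I a) k)
      _ = ∑ x : ι → SignType, (∏ i, sparseWeight r (x i)) * ∑ a ∈ vectorsWithSupport p I,
          (if ∑ i ∈ J, (x i : ZMod p) * a i = 0 ∧ ∃ j ∈ J, x j ≠ 0 then 1 else 0) *
            minRelationProb r s I a ^ k := by
          simp_rw [relationProb, sum_mul, mul_sum]
          rw [sum_comm]
          simp_rw [mul_assoc]
      _ ≤ ∑ x : ι → SignType, (∏ i, sparseWeight r (x i)) * (p : ℝ) ^ s :=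
          sum_le_sum fun x _ => mul_le_mul_of_nonneg_left (step x)
            (prod_nonneg fun _ _ => sparseWeight_nonneg h0 h1 _)
      _ = (p : ℝ) ^ s := by rw [← sum_mul, sum_prod_sparseWeight, one_mul]

end Counting

/-! ### Orthogonality of prescribed rows of a random symmetric sign matrix. -/

section SymmetricMatrices

lemma finite_symmSignMatrices (n : ℕ) : (symmSignMatrices n).Finite := by
  have h : (Set.pi Set.univ fun _ : Fin n => Set.pi Set.univ fun _ : Fin n =>
      ({1, -1} : Set ℤ)).Finite :=
    Set.Finite.pi fun _ => Set.Finite.pi fun _ => Set.toFinite _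
  exact h.subset fun M hM i _ j _ => hM.2 i j

lemma nonempty_symmSignMatrices (n : ℕ) : (symmSignMatrices n).Nonempty :=
  ⟨Matrix.of fun _ _ => 1, by ext; simp, fun _ _ => Or.inl rfl⟩

/-- The symmetric sign matrices as a finite set. -/
noncomputable def symmSignFinset (n : ℕ) : Finset (Matrix (Fin n) (Fin n) ℤ) :=
  (finite_symmSignMatrices n).toFinset

lemma mem_symmSignFinset {n : ℕ} {M : Matrix (Fin n) (Fin n) ℤ} :
    M ∈ symmSignFinset n ↔ M.IsSymm ∧ ∀ i j, M i j = 1 ∨ M i j = -1 := by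
  simp [symmSignFinset, symmSignMatrices]

instance (n : ℕ) : IsProbabilityMeasure (symmSignLaw n) :=
  have : DiscreteMeasurableSpace (Matrix (Fin n) (Fin n) ℤ) := ⟨fun _ => trivial⟩
  isProbabilityMeasure_uniformOn (finite_symmSignMatrices n) (nonempty_symmSignMatrices n)

lemma symmSignLaw_real_eq {n : ℕ} (A : Set (Matrix (Fin n) (Fin n) ℤ)) [DecidablePred (· ∈ A)] :
    (symmSignLaw n).real A = (∑ M ∈ symmSignFinset n, if M ∈ A then 1 else 0) /
      #(symmSignFinset n) := by
  classical
  have : DiscreteMeasurableSpace (Matrix (Fin n) (Fin n) ℤ) := ⟨fun _ => trivial⟩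
  have hS : symmSignMatrices n = ↑(symmSignFinset n) := by simp [symmSignFinset]
  rw [measureReal_def, symmSignLaw, ← uniformOn_inter_self (finite_symmSignMatrices n)]
  have hA : symmSignMatrices n ∩ A = ↑((symmSignFinset n).filter (· ∈ A)) := by
    ext M; simp [hS]
  rw [hA, hS, uniformOn_apply_finset, inter_eq_right.2 (filter_subset _ _)]
  simp

/-- Entrywise multiplication by D is an involution of the symmetric sign matrices. This invariance
replaces conditioning on the entries outside a block. -/
lemma sum_hadamard {n : ℕ} {D : Matrix (Fin n) (Fin n) ℤ} (hD : D ∈ symmSignFinset n)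
    (f : Matrix (Fin n) (Fin n) ℤ → ℝ) :
    ∑ M ∈ symmSignFinset n, f (M.hadamard D) = ∑ M ∈ symmSignFinset n, f M := by
  rw [mem_symmSignFinset] at hD
  have hmem : ∀ M ∈ symmSignFinset n, M.hadamard D ∈ symmSignFinset n := fun M hM => by
    rw [mem_symmSignFinset] at *
    refine ⟨Matrix.IsSymm.ext fun i j => ?_, fun i j => ?_⟩
    · simp [Matrix.hadamard_apply, hM.1.apply, hD.1.apply]
    · rw [Matrix.hadamard_apply]
      rcases hM.2 i j with h | h <;> rcases hD.2 i j with h' | h' <;> simp [h, h']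
  have hinv : ∀ M : Matrix (Fin n) (Fin n) ℤ, (M.hadamard D).hadamard D = M := fun M => by
    ext i j
    rcases hD.2 i j with h | h <;> simp [Matrix.hadamard_apply, h]
  exact sum_nbij' (fun M => M.hadamard D) (fun M => M.hadamard D) hmem hmem
    (fun M _ => hinv M) (fun M _ => hinv M) fun M _ => rfl

/-- The symmetric sign matrix that agrees with `ε` on `T × J` and is `1` outside this block and
its transpose. -/
def blockSigns {n : ℕ} (T J : Finset (Fin n)) (ε : Fin n → Fin n → ℤˣ) :
    Matrix (Fin n) (Fin n) ℤ :=
  fun i j => if i ∈ T ∧ j ∈ J then ε i j else if j ∈ T ∧ i ∈ J then ε j i else 1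

lemma blockSigns_mem {n : ℕ} {T J : Finset (Fin n)} (h : Disjoint T J)
    (ε : Fin n → Fin n → ℤˣ) : blockSigns T J ε ∈ symmSignFinset n := by
  rw [mem_symmSignFinset]
  refine ⟨Matrix.IsSymm.ext fun i j => ?_, fun i j => ?_⟩
  · have h' := disjoint_left.1 h
    unfold blockSigns
    by_cases h1 : i ∈ T ∧ j ∈ J <;> by_cases h2 : j ∈ T ∧ i ∈ J
    · exact absurd h2.2 (h' h1.1)
    · rw [if_neg h2, if_pos h1, if_pos h1]
    · rw [if_pos h2, if_neg h1, if_pos h2]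
    · rw [if_neg h2, if_neg h1, if_neg h1, if_neg h2]
  · have hu : ∀ u : ℤˣ, (u : ℤ) = 1 ∨ (u : ℤ) = -1 := fun u => by
      rcases Int.units_eq_one_or u with h | h <;> simp [h]
    unfold blockSigns
    split_ifs
    · exact hu _
    · exact hu _
    · exact Or.inl rfl

variable {p : ℕ} [Fact p.Prime]

/-- The probability that prescribed rows of the random symmetric matrix are orthogonal to `a`. -/
lemma symmSignLaw_rows_le (hp : p ≠ 2) {n : ℕ} {T J : Finset (Fin n)} (h : Disjoint T J)
    (a : Fin n → ZMod p) :
    (symmSignLaw n).real {M | ∀ i ∈ T, ∑ j, (M i j : ZMod p) * a j = 0}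
      ≤ expSum (trunc J a) ^ #T := by
  classical
  set A : Set (Matrix (Fin n) (Fin n) ℤ) := {M | ∀ i ∈ T, ∑ j, (M i j : ZMod p) * a j = 0} with hA
  set ind : Matrix (Fin n) (Fin n) ℤ → ℝ := fun M => if M ∈ A then 1 else 0 with hind
  set W : ℝ := ∏ _i : Fin n, ∏ _j : Fin n, (1 / 2 : ℝ) with hW
  have hone : ∑ y : Fin n → ℤˣ, ∏ _j : Fin n, (1 / 2 : ℝ) = 1 := by
    rw [← Fintype.prod_sum fun (_ : Fin n) (_ : ℤˣ) => (1 / 2 : ℝ)]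
    simp
  have hWsum : ∑ ε : Fin n → Fin n → ℤˣ, W = 1 := by
    rw [hW, ← Fintype.prod_sum fun (_ : Fin n) (_ : Fin n → ℤˣ) => ∏ _j : Fin n, (1 / 2 : ℝ)]
    simp
  -- With M fixed, only the block is rerandomised. Row i in T then depends only on `ε i`: since i ∉
  -- J, the transposed block does not meet it. The probability factors over T, with the entries
  -- outside J as constant shifts.
  have key : ∀ M ∈ symmSignFinset n, ∑ ε : Fin n → Fin n → ℤˣ,
      W * ind (M.hadamard (blockSigns T J ε)) ≤ expSum (trunc J a) ^ #T := by
    intro M hM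
    rw [mem_symmSignFinset] at hM
    set b : Fin n → Fin n → ZMod p := fun i => trunc J fun j => (M i j : ZMod p) * a j with hb
    set c : Fin n → ZMod p := fun i => ∑ j ∈ Jᶜ, (M i j : ZMod p) * a j with hc
    set f : Fin n → (Fin n → ℤˣ) → ℝ := fun i y => if i ∈ T then
      (if ∑ j, ((y j : ℤ) : ZMod p) * b i j = -c i then 1 else 0) else 1 with hf
    have hrow : ∀ ε : Fin n → Fin n → ℤˣ, ∀ i ∈ T,
        ∑ j, ((M.hadamard (blockSigns T J ε) i j : ℤ) : ZMod p) * a j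
          = ∑ j, ((ε i j : ℤ) : ZMod p) * b i j + c i := by
      intro ε i hi
      rw [sum_trunc, hc, ← sum_add_sum_compl J]
      congr 1
      · refine sum_congr rfl fun j hj => ?_
        simp only [Matrix.hadamard_apply, blockSigns, hi, hj, and_self, if_true]
        push_cast; ring
      · refine sum_congr rfl fun j hj => ?_
        simp [Matrix.hadamard_apply, blockSigns, hi, mem_compl.1 hj, disjoint_left.1 h hi]
    have hindf : ∀ ε : Fin n → Fin n → ℤˣ,
        W * ind (M.hadamard (blockSigns T J ε)) = ∏ i, (∏ _j : Fin n, (1 / 2 : ℝ)) * f i (ε i) := by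
      intro ε
      rw [prod_mul_distrib]
      refine congrArg _ ?_
      simp only [hind]
      split_ifs with hm
      · refine (prod_eq_one fun i _ => ?_).symm
        simp only [hf]
        split_ifs with hi hs
        · rfl
        · exact absurd (eq_neg_of_add_eq_zero_left ((hrow ε i hi).symm.trans (hm i hi))) hs
        · rfl
      · simp only [hA, Set.mem_ofPred_eq, not_forall] at hm
        obtain ⟨i, hi, hne⟩ := hm
        refine (prod_eq_zero (mem_univ i) ?_).symm
        simp only [hf]
        rw [if_pos hi, if_neg]
        intro hs
        rw [hrow ε i hi, hs, neg_add_cancel] at hne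
        exact hne rfl
    simp_rw [hindf]
    rw [← Fintype.prod_sum fun (i : Fin n) y => (∏ _j : Fin n, (1 / 2 : ℝ)) * f i y,
      ← prod_const, ← prod_subset (subset_univ T)]
    · refine prod_le_prod (fun i _ => sum_nonneg fun y _ => ?_) fun i hi => ?_
      · refine mul_nonneg (by positivity) ?_
        simp only [hf]; split_ifs <;> norm_num
      · have hbe : expSum (b i) = expSum (trunc J a) := expSum_congr fun j => by
          by_cases hj : j ∈ J
          · rcases hM.2 i j with h | h <;> simp [hb, trunc, hj, h]
          · simp [hb, trunc, hj]
        rw [← hbe]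
        simp only [hf, hi, if_true]
        exact sum_sign_ite_le hp (b i) (-c i)
    · intro i _ hi
      simp only [hf, hi, if_false, mul_one]
      exact hone
  have hcard : (0 : ℝ) < #(symmSignFinset n) := by
    rw [Nat.cast_pos, card_pos]
    obtain ⟨M, hM⟩ := nonempty_symmSignMatrices n
    exact ⟨M, by simpa [symmSignFinset] using hM⟩
  rw [symmSignLaw_real_eq, div_le_iff₀ hcard]
  calc ∑ M ∈ symmSignFinset n, ind M
      = ∑ ε : Fin n → Fin n → ℤˣ, W * ∑ M ∈ symmSignFinset n, ind M := by
        rw [← sum_mul, hWsum, one_mul]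
    _ = ∑ ε : Fin n → Fin n → ℤˣ, W * ∑ M ∈ symmSignFinset n,
          ind (M.hadamard (blockSigns T J ε)) := by
        refine sum_congr rfl fun ε _ => ?_
        rw [sum_hadamard (blockSigns_mem h ε)]
    _ = ∑ M ∈ symmSignFinset n, ∑ ε : Fin n → Fin n → ℤˣ,
          W * ind (M.hadamard (blockSigns T J ε)) := by
        simp_rw [mul_sum]
        rw [sum_comm]
    _ ≤ ∑ M ∈ symmSignFinset n, expSum (trunc J a) ^ #T := sum_le_sum key
    _ = expSum (trunc J a) ^ #T * #(symmSignFinset n) := by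
        rw [sum_const, nsmul_eq_mul, mul_comm]

end SymmetricMatrices

/-! ### Union bound over exceptional rows and over vectors. -/

section UnionBound

lemma card_filter_card_le {ι : Type*} [Fintype ι] [DecidableEq ι] (k : ℕ) :
    #{I : Finset ι | #I ≤ k} ≤ (Fintype.card ι + 1) ^ k := by
  have h : ({I : Finset ι | #I ≤ k} : Finset (Finset ι)) ⊆
      (range (k + 1)).biUnion fun j => powersetCard j univ := by
    intro I hI
    simp only [mem_filter, mem_univ, true_and] at hI
    simp only [mem_biUnion, mem_range, mem_powersetCard, subset_univ, true_and]
    exact ⟨_, Nat.lt_succ_of_le hI, rfl⟩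
  calc _ ≤ _ := card_le_card h
    _ ≤ ∑ j ∈ range (k + 1), #(powersetCard j (univ : Finset ι)) := card_biUnion_le
    -- The harmless factor `k.choose j` ≥ 1 makes this the binomial expansion of (card + 1)^k.
    _ ≤ ∑ j ∈ range (k + 1), Fintype.card ι ^ j * 1 ^ (k - j) * k.choose j := by
        refine sum_le_sum fun j hj => ?_
        rw [card_powersetCard, card_univ, one_pow, mul_one]
        exact (Nat.choose_le_pow _ _).trans (Nat.le_mul_of_pos_right _
          (Nat.choose_pos (Nat.lt_succ_iff.1 (mem_range.1 hj))))
    _ = _ := by rw [add_pow]; simp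

variable {p : ℕ} [Fact p.Prime]

lemma mem_vectorsWithSupport_filter {ι : Type*} [Fintype ι] [DecidableEq ι] (a : ι → ZMod p) :
    a ∈ vectorsWithSupport p {i | a i ≠ 0} := by
  simp [mem_vectorsWithSupport]

/-- On [0, 1] one has exp(-x/4) ≤ 1 - x/5, and `chordSq` averages 1/2 along a nonzero coordinate,
giving 1 - 1/10. -/
lemma expSum_trunc_singleton_le {ι : Type*} [Fintype ι] [DecidableEq ι] {a : ι → ZMod p} {j : ι}
    (hj : a j ≠ 0) : expSum (trunc {j} a) ≤ 9 / 10 := by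
  have hp : (0 : ℝ) < p := by exact_mod_cast (Fact.out : p.Prime).pos
  have hE : ∀ η, energy (trunc {j} a) η = chordSq (a j * η) := fun η => by
    rw [energy, sum_eq_single j (fun i _ hi => by simp [trunc, hi]) (by simp)]
    simp [trunc]
  have h1 : ∀ x : ℝ, 0 ≤ x → x ≤ 1 → Real.exp (-x / 4) ≤ 1 - x / 5 := fun x h0 h1 => by
    rw [neg_div, Real.exp_neg]
    refine inv_le_of_inv_le₀ (by linarith) (le_trans ?_ (Real.add_one_le_exp _))
    rw [inv_le_iff_one_le_mul₀ (by linarith)]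
    nlinarith
  calc expSum (trunc {j} a) ≤ (1 / p) * ∑ η : ZMod p, (1 - chordSq (a j * η) / 5) := by
        unfold expSum
        gcongr with η
        rw [hE]
        exact h1 _ (chordSq_nonneg _) (chordSq_le_one _)
    _ = 9 / 10 := by
        rw [sum_sub_distrib, ← sum_div, sum_chordSq_mul hj]
        simp only [sum_const, card_univ, ZMod.card, nsmul_eq_mul, mul_one]
        field_simp
        norm_num

/-- The event that all rows with index in `T` are orthogonal to `a`. -/
def rowsOrthogonal {n : ℕ} (T : Finset (Fin n)) (a : Fin n → ZMod p) :
    Set (Matrix (Fin n) (Fin n) ℤ) := {M | ∀ i ∈ T, ∑ j, (M i j : ZMod p) * a j = 0}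

/-- Discarding the rows indexed by J makes the row set disjoint from J, at the cost of at most `#J`
factors. -/
lemma symmSignLaw_rowsOrthogonal_le (hp : p ≠ 2) {n N : ℕ} (T J : Finset (Fin n))
    (a : Fin n → ZMod p) (hN : N + #J ≤ #T) {c : ℝ} (hc : expSum (trunc J a) ≤ c) (hc1 : c ≤ 1) :
    (symmSignLaw n).real (rowsOrthogonal T a) ≤ c ^ N := by
  have hsub : rowsOrthogonal T a ⊆ rowsOrthogonal (T \ J) a :=
    fun M hM i hi => hM i (mem_sdiff.1 hi).1
  have hcard : N ≤ #(T \ J) := by have := le_card_sdiff J T; omega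
  have h0 := expSum_nonneg (trunc J a)
  calc _ ≤ (symmSignLaw n).real (rowsOrthogonal (T \ J) a) := measureReal_mono hsub
    _ ≤ expSum (trunc J a) ^ #(T \ J) := symmSignLaw_rows_le hp sdiff_disjoint a
    _ ≤ c ^ #(T \ J) := pow_le_pow_left₀ h0 hc _
    _ ≤ c ^ N := pow_le_pow_of_le_one (h0.trans hc) hc1 hcard

lemma sum_small_support_le (hp : p ≠ 2) {n b s : ℕ} {T : Finset (Fin n)} (hT : n ≤ #T + b) :
    ∑ a ∈ {a : Fin n → ZMod p | a ≠ 0 ∧ #{i | a i ≠ 0} ≤ s},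
      (symmSignLaw n).real (rowsOrthogonal T a)
        ≤ (n + 1 : ℝ) ^ s * (p : ℝ) ^ s * (9 / 10) ^ (n - b - 1) := by
  have hcard : #{a : Fin n → ZMod p | a ≠ 0 ∧ #{i | a i ≠ 0} ≤ s} ≤ (n + 1) ^ s * p ^ s := by
    have h : ({a : Fin n → ZMod p | a ≠ 0 ∧ #{i | a i ≠ 0} ≤ s} : Finset _) ⊆
        ({I : Finset (Fin n) | #I ≤ s} : Finset _).biUnion (vectorsWithSupport p) := by
      intro a ha
      rw [mem_biUnion]
      exact ⟨_, mem_filter.2 ⟨mem_univ _, (mem_filter.1 ha).2.2⟩, mem_vectorsWithSupport_filter a⟩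
    calc _ ≤ _ := card_le_card h
      _ ≤ _ := card_biUnion_le
      _ ≤ ∑ I ∈ {I : Finset (Fin n) | #I ≤ s}, p ^ s := by
          refine sum_le_sum fun I hI => (card_vectorsWithSupport_le I).trans ?_
          exact Nat.pow_le_pow_right (Fact.out : p.Prime).pos (mem_filter.1 hI).2
      _ ≤ _ := by
          rw [sum_const, smul_eq_mul]
          refine Nat.mul_le_mul_right _ ?_
          simpa using card_filter_card_le (ι := Fin n) s
  have hterm : ∀ a ∈ ({a : Fin n → ZMod p | a ≠ 0 ∧ #{i | a i ≠ 0} ≤ s} : Finset _),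
      (symmSignLaw n).real (rowsOrthogonal T a) ≤ (9 / 10) ^ (n - b - 1) := by
    intro a ha
    obtain ⟨j, hj⟩ := Function.ne_iff.1 (mem_filter.1 ha).2.1
    by_cases hn : n - b - 1 = 0
    · rw [hn, pow_zero]; exact measureReal_le_one
    · exact symmSignLaw_rowsOrthogonal_le hp T {j} a (by rw [card_singleton]; omega)
        (expSum_trunc_singleton_le hj) (by norm_num)
  refine (sum_le_sum hterm).trans ?_
  rw [sum_const, nsmul_eq_mul]
  gcongr
  exact_mod_cast hcard

lemma expSum_trunc_le_relationProb {ι : Type*} [Fintype ι] [DecidableEq ι] (t : ℕ)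
    {a : ι → ZMod p} {J : Finset ι} (hJ : ∀ j ∈ J, a j ≠ 0) :
    expSum (trunc J a) ≤ Real.exp (-(#J : ℝ) / (8 * 4 ^ t)) + 1 / p +
      (1 - 1 / (16 * 4 ^ t)) ^ #J / 2 ^ t + relationProb (1 / (16 * 4 ^ t)) J a / 2 ^ t := by
  have hsupp : ({i | trunc J a i ≠ 0} : Finset ι) = J := by
    ext i
    by_cases hi : i ∈ J <;> simp [trunc, hi, hJ]
  have h4 : (1 : ℝ) ≤ 4 ^ t := one_le_pow₀ (by norm_num)
  have h1 : 1 / (16 * 4 ^ t : ℝ) ≤ 1 := by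
    rw [div_le_one (by positivity)]; linarith
  have h := expSum_le_zeroProb (trunc J a) t
  rw [hsupp] at h
  have h2 : zeroProb (1 / (16 * 4 ^ t)) (trunc J a) / 2 ^ t ≤
      (relationProb (1 / (16 * 4 ^ t)) J a + (1 - 1 / (16 * 4 ^ t)) ^ #J) / 2 ^ t := by
    gcongr
    exact zeroProb_trunc_le (by positivity) h1 J a
  rw [add_div] at h2
  linarith

/-- The vectors with support of size at least `s` that have a large lazy atom probability. -/
def HasLargeAtom {n : ℕ} (α : ℝ) (s : ℕ) (a : Fin n → ZMod p) : Prop :=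
  s ≤ #{i | a i ≠ 0} ∧ ∃ μ : ℝ, 0 ≤ μ ∧ μ ≤ 1 / 2 ∧ α < atomProb μ a

/-- The row bound is applied to the s-subset J that attains the minimum q. It is then rewritten with
the exponent |I| - s required by the counting lemma. -/
lemma symmSignLaw_rowsOrthogonal_le_minRelationProb (hp : p ≠ 2) {n b s t : ℕ} (ht : 1 ≤ t)
    {α : ℝ} (hα : 0 < α)
    (hδ : Real.exp (-(s : ℝ) / (8 * 4 ^ t)) + 1 / p + (1 - 1 / (16 * 4 ^ t)) ^ s / 2 ^ t ≤ α / 2)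
    {T : Finset (Fin n)} (hT : n ≤ #T + b) {a : Fin n → ZMod p} (ha : HasLargeAtom α s a)
    {I : Finset (Fin n)} (hI : a ∈ vectorsWithSupport p I) :
    (symmSignLaw n).real (rowsOrthogonal T a) ≤
      (2 / 2 ^ t) ^ (n - b - s) * α⁻¹ ^ b *
        minRelationProb (1 / (16 * 4 ^ t)) s I a ^ (#I - s) := by
  have hsupp : ({i | a i ≠ 0} : Finset (Fin n)) = I := by
    ext i; simpa using mem_vectorsWithSupport.1 hI i
  obtain ⟨hs, μ, hμ0, hμ1, hμ⟩ := ha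
  rw [hsupp] at hs
  have h4 : (1 : ℝ) ≤ 4 ^ t := one_le_pow₀ (by norm_num)
  have h2 : (2 : ℝ) ≤ 2 ^ t := by simpa using pow_le_pow_right₀ (by norm_num : (1 : ℝ) ≤ 2) ht
  have h2pos : (0 : ℝ) < 2 ^ t := by positivity
  set r : ℝ := 1 / (16 * 4 ^ t) with hr
  have hr0 : 0 ≤ r := by positivity
  have hr1 : r ≤ 1 := by rw [hr, div_le_one (by positivity)]; linarith
  obtain ⟨J, hJI, hJs, hJ⟩ := exists_minRelationProb_eq r hs a
  have hle := expSum_trunc_le_relationProb t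
    (a := a) (J := J) fun j hj => (mem_vectorsWithSupport.1 hI j).2 (hJI hj)
  rw [hJs, ← hr, hJ] at hle
  have hq1 : minRelationProb r s I a ≤ 1 := hJ ▸ relationProb_le_one hr0 hr1 J a
  set q := minRelationProb r s I a with hq
  have hαle : α < expSum (trunc J a) :=
    hμ.trans_le ((atomProb_le_expSum hp hμ0 hμ1 a).trans (expSum_le_trunc J a))
  -- The error terms use up at most half of α, so the relation term must supply the other half and
  -- dominates them.
  have hqα : α / 2 ≤ q / 2 ^ t := by linarith
  have hexp : expSum (trunc J a) ≤ 2 / 2 ^ t * q := by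
    have : 2 / 2 ^ t * q = q / 2 ^ t + q / 2 ^ t := by ring
    linarith
  have hαq : α ≤ q := by
    rw [le_div_iff₀ h2pos] at hqα
    nlinarith
  have hq0 : 0 < q := hα.trans_le hαq
  have hc1 : 2 / 2 ^ t * q ≤ 1 :=
    mul_le_one₀ ((div_le_one h2pos).2 h2) hq0.le hq1
  have hprob : (symmSignLaw n).real (rowsOrthogonal T a) ≤ (2 / 2 ^ t * q) ^ (n - b - s) := by
    by_cases hn : n - b - s = 0
    · rw [hn, pow_zero]; exact measureReal_le_one
    · exact symmSignLaw_rowsOrthogonal_le hp T J a (by omega) hexp hc1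
  refine hprob.trans ?_
  rw [mul_pow, mul_assoc]
  refine mul_le_mul_of_nonneg_left ?_ (by positivity)
  have hIn : #I ≤ n := by simpa using card_le_univ I
  -- The b exceptional rows contribute no factor q. As q ≥ α, the missing q^b is restored at the
  -- price α^{-b}.
  have h1 : q ^ (n - b - s) * α ^ b ≤ q ^ (#I - s) :=
    calc q ^ (n - b - s) * α ^ b ≤ q ^ (n - b - s) * q ^ b := by gcongr
      _ = q ^ (n - b - s + b) := (pow_add _ _ _).symm
      _ ≤ q ^ (#I - s) := pow_le_pow_of_le_one hq0.le hq1 (by omega)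
  rw [inv_pow, inv_mul_eq_div, le_div_iff₀ (by positivity)]
  exact h1

lemma sum_large_support_le (hp : p ≠ 2) {n b s t : ℕ} (ht : 1 ≤ t) {α : ℝ} (hα : 0 < α)
    (hδ : Real.exp (-(s : ℝ) / (8 * 4 ^ t)) + 1 / p + (1 - 1 / (16 * 4 ^ t)) ^ s / 2 ^ t ≤ α / 2)
    {T : Finset (Fin n)} (hT : n ≤ #T + b)
    [DecidablePred (HasLargeAtom (p := p) (n := n) α s)] :
    ∑ a ∈ {a : Fin n → ZMod p | HasLargeAtom α s a},
      (symmSignLaw n).real (rowsOrthogonal T a)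
        ≤ 2 ^ n * (p : ℝ) ^ s * ((2 / 2 ^ t) ^ (n - b - s) * α⁻¹ ^ b) := by
  set C : ℝ := (2 / 2 ^ t) ^ (n - b - s) * α⁻¹ ^ b with hC
  have hC0 : 0 ≤ C := by positivity
  set r : ℝ := 1 / (16 * 4 ^ t) with hr
  have h4 : (1 : ℝ) ≤ 4 ^ t := one_le_pow₀ (by norm_num)
  have hr0 : 0 ≤ r := by positivity
  have hr1 : r ≤ 1 := by rw [hr, div_le_one (by positivity)]; linarith
  set X : Finset (Fin n → ZMod p) := {a | HasLargeAtom α s a} with hX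
  have hmaps : ∀ a ∈ X, ({i | a i ≠ 0} : Finset (Fin n)) ∈
      ({I : Finset (Fin n) | s ≤ #I} : Finset _) := fun a ha => by
    simpa using (mem_filter.1 ha).2.1
  rw [← sum_fiberwise_of_maps_to hmaps]
  calc _ ≤ ∑ I ∈ ({I : Finset (Fin n) | s ≤ #I} : Finset _), C * (p : ℝ) ^ s := by
        refine sum_le_sum fun I hI => ?_
        refine le_trans ?_ (mul_le_mul_of_nonneg_left
          (sum_minRelationProb_pow_le (p := p) hr0 hr1 s (#I - s) I
            (by have := (mem_filter.1 hI).2; omega)) hC0)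
        rw [mul_sum]
        have hsub : X.filter (fun a => ({i | a i ≠ 0} : Finset (Fin n)) = I) ⊆
            vectorsWithSupport p I := fun a ha => by
          rw [← (mem_filter.1 ha).2]; exact mem_vectorsWithSupport_filter a
        refine le_trans (sum_le_sum fun a ha => ?_) (sum_le_sum_of_subset_of_nonneg hsub
          fun a _ _ => mul_nonneg hC0 (pow_nonneg (minRelationProb_nonneg hr0 hr1 s I a) _))
        exact symmSignLaw_rowsOrthogonal_le_minRelationProb hp ht hα hδ hT
          (mem_filter.1 (mem_filter.1 ha).1).2 (hsub ha)
    _ ≤ 2 ^ n * (C * (p : ℝ) ^ s) := by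
        rw [sum_const, nsmul_eq_mul]
        refine mul_le_mul_of_nonneg_right ?_ (by positivity)
        have : #({I : Finset (Fin n) | s ≤ #I} : Finset _) ≤ 2 ^ n :=
          (card_filter_le _ _).trans (by simp)
        exact_mod_cast this
    _ = _ := by ring

/-- The union bound over the orthogonal rows and over the vectors. -/
lemma symmSignLaw_orthEvent_compl_le (hp : p ≠ 2) {n b s t : ℕ} (ht : 1 ≤ t) {α β : ℝ}
    (hα : 0 < α) (hβ : β * n < b + 1)
    (hδ : Real.exp (-(s : ℝ) / (8 * 4 ^ t)) + 1 / p + (1 - 1 / (16 * 4 ^ t)) ^ s / 2 ^ t ≤ α / 2) :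
    (symmSignLaw n).real (orthEvent (ZMod p) α β n)ᶜ ≤ (n + 1 : ℝ) ^ b *
      ((n + 1 : ℝ) ^ s * (p : ℝ) ^ s * (9 / 10) ^ (n - b - 1) +
        2 ^ n * (p : ℝ) ^ s * ((2 / 2 ^ t) ^ (n - b - s) * α⁻¹ ^ b)) := by
  classical
  set 𝒯 : Finset (Finset (Fin n)) := {T | #Tᶜ ≤ b} with h𝒯
  set X : Finset (Fin n → ZMod p) := {a | a ≠ 0 ∧ #{i | a i ≠ 0} ≤ s} with hX
  set Y : Finset (Fin n → ZMod p) := {a | HasLargeAtom α s a} with hY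
  have hsub : (orthEvent (ZMod p) α β n)ᶜ ⊆ ⋃ T ∈ 𝒯,
      ((⋃ a ∈ X, rowsOrthogonal T a) ∪ ⋃ a ∈ Y, rowsOrthogonal T a) := by
    intro M hM
    simp only [orthEvent, Set.mem_compl_iff, Set.mem_ofPred_eq, not_forall, not_le] at hM
    obtain ⟨a, ha0, hrows, μ, hμ0, hμ1, hμ⟩ := hM
    set T : Finset (Fin n) := {i | ∑ j, (M i j : ZMod p) * a j = 0} with hT
    have hTc : orthRows M a = #T := by
      rw [orthRows, ← Set.ncard_coe_finset]; congr 1; ext i; simp [hT]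
    have hTb : T ∈ 𝒯 := by
      rw [h𝒯, mem_filter]
      refine ⟨mem_univ _, ?_⟩
      have h1 := card_add_card_compl T
      rw [Fintype.card_fin] at h1
      have h2 : (#T : ℝ) + #Tᶜ = n := by exact_mod_cast h1
      rw [hTc] at hrows
      -- The number of exceptional rows is an integer at most βn < b + 1, hence at most b.
      have h3 : (#Tᶜ : ℝ) < b + 1 := by linarith
      exact Nat.lt_succ_iff.1 (by exact_mod_cast h3)
    have hmem : M ∈ rowsOrthogonal T a := fun i hi => (mem_filter.1 hi).2
    rw [Set.mem_iUnion₂]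
    refine ⟨T, hTb, ?_⟩
    by_cases hs : #{i | a i ≠ 0} ≤ s
    · exact Or.inl (Set.mem_iUnion₂.2 ⟨a, mem_filter.2 ⟨mem_univ _, ha0, hs⟩, hmem⟩)
    · exact Or.inr (Set.mem_iUnion₂.2 ⟨a, mem_filter.2 ⟨mem_univ _, (not_le.1 hs).le, μ, hμ0, hμ1,
        hμ⟩, hmem⟩)
  have hcard : (#𝒯 : ℝ) ≤ (n + 1 : ℝ) ^ b := by
    have h : #𝒯 ≤ #{I : Finset (Fin n) | #I ≤ b} :=
      card_le_card_of_injOn compl (fun T hT => by simpa [h𝒯] using hT)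
        compl_injective.injOn
    have h2 := h.trans (card_filter_card_le (ι := Fin n) b)
    rw [Fintype.card_fin] at h2
    exact_mod_cast h2
  refine (measureReal_mono hsub (measure_ne_top _ _)).trans ((measureReal_biUnion_finset_le _ _).trans ?_)
  refine (sum_le_sum fun T hT => ?_).trans ((sum_const _).trans_le
    ((nsmul_eq_mul _ _).trans_le (mul_le_mul_of_nonneg_right hcard (by positivity))))
  have hTb : n ≤ #T + b := by
    have h1 := card_add_card_compl T
    rw [Fintype.card_fin] at h1
    have := (mem_filter.1 hT).2
    omega
  exact (measureReal_union_le _ _).trans (add_le_add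
    ((measureReal_biUnion_finset_le _ _).trans (sum_small_support_le hp hTb))
    ((measureReal_biUnion_finset_le _ _).trans (sum_large_support_le hp ht hα hδ hTb)))

end UnionBound

/-! ### Numerical estimates and choice of parameters. -/

section Asymptotics

open Filter

/-- The scale `n ^ (1 / 4) √(log n)`. -/
noncomputable def rootScale (n : ℕ) : ℝ := (n : ℝ) ^ (1 / 4 : ℝ) * √(Real.log n)

lemma betaParam_mul {n : ℕ} (hn : 0 < n) : betaParam n * n = rootScale n / 128 := by
  have hn' : (0 : ℝ) < n := by exact_mod_cast hn
  have h : (n : ℝ) ^ (-(3 / 4) : ℝ) * n = (n : ℝ) ^ (1 / 4 : ℝ) := by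
    rw [← Real.rpow_add_one hn'.ne']; norm_num
  rw [betaParam, rootScale, ← h]; ring

/-- With x = n^{1/4}, eventually log n ≤ min(1, ε/4) x. Then L² = x² log n ≤ x³ ≤ εx⁴ = εn, and
log(n + 1) ≤ 2 log n ≤ εx/2 with log 2 ≥ 1/2 gives the last bound. -/
lemma eventually_scale_bounds {ε K : ℝ} (hε : 0 < ε) : ∀ᶠ n : ℕ in atTop,
    K ≤ rootScale n ∧ rootScale n ^ 2 ≤ ε * n ∧ Real.logb 2 (n + 1) ≤ ε * rootScale n := by
  have hcast := tendsto_natCast_atTop_atTop (R := ℝ)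
  have hc : 0 < min 1 (ε / 4) := by positivity
  have h1 := hcast.eventually ((isLittleO_log_rpow_atTop (r := 1 / 4) (by norm_num)).bound hc)
  have h2 := hcast.eventually
    ((tendsto_rpow_atTop (y := 1 / 4) (by norm_num)).eventually_ge_atTop (max K (1 / ε)))
  have h3 := hcast.eventually (Real.tendsto_log_atTop.eventually_ge_atTop 1)
  filter_upwards [h1, h2, h3, eventually_ge_atTop 2] with n h1 h2 h3 hn
  have hn' : (2 : ℝ) ≤ n := by exact_mod_cast hn
  have hn0 : (0 : ℝ) < n := by linarith
  set x : ℝ := (n : ℝ) ^ (1 / 4 : ℝ) with hx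
  have hx0 : 0 < x := Real.rpow_pos_of_pos hn0 _
  have hx4 : x ^ 4 = n := by
    rw [hx, ← Real.rpow_natCast, ← Real.rpow_mul hn0.le]; norm_num
  rw [Real.norm_of_nonneg (by linarith), Real.norm_of_nonneg hx0.le] at h1
  have hl1 : Real.log n ≤ x := h1.trans (mul_le_of_le_one_left hx0.le (min_le_left _ _))
  have hl2 : Real.log n ≤ ε / 4 * x :=
    h1.trans (mul_le_mul_of_nonneg_right (min_le_right _ _) hx0.le)
  have hs1 : 1 ≤ √(Real.log n) := Real.one_le_sqrt.2 h3
  have hxL : x ≤ rootScale n := le_mul_of_one_le_right hx0.le hs1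
  have hxK := (le_max_left _ _).trans h2
  have hxε := (le_max_right _ _).trans h2
  rw [div_le_iff₀ hε] at hxε
  refine ⟨hxK.trans hxL, ?_, ?_⟩
  · have hsq : rootScale n ^ 2 = x ^ 2 * Real.log n := by
      rw [rootScale, mul_pow, Real.sq_sqrt (by linarith)]
    rw [hsq]
    have : x ^ 2 * Real.log n ≤ x ^ 2 * x := by gcongr
    have : x ^ 3 * 1 ≤ x ^ 3 * (x * ε) := by gcongr
    have : ε * n = ε * x ^ 4 := by rw [hx4]
    nlinarith
  · have hlog : Real.log (n + 1) ≤ 2 * Real.log n := by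
      rw [← Real.log_rpow hn0]
      refine Real.log_le_log (by linarith) ?_
      rw [Real.rpow_two]; nlinarith
    have h2log : (1 / 2 : ℝ) ≤ Real.log 2 := by linarith [Real.log_two_gt_d9]
    rw [Real.logb, div_le_iff₀ (by linarith)]
    have hL0 : 0 ≤ ε * rootScale n := mul_nonneg hε.le (hx0.le.trans hxL)
    have : ε * x * (1 / 2) ≤ ε * rootScale n * Real.log 2 := by gcongr
    linarith

lemma alphaParam_eq (n : ℕ) : alphaParam n = (2 : ℝ) ^ (-(rootScale n / 64)) := by
  rw [alphaParam, rootScale, neg_div]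

lemma primeSize_eq (n : ℕ) : primeSize n = (2 : ℝ) ^ (rootScale n / 32) := rfl

lemma exp_neg_le_two_rpow {x : ℝ} (hx : 0 ≤ x) : Real.exp (-x) ≤ (2 : ℝ) ^ (-x) := by
  rw [Real.rpow_def_of_pos (by norm_num)]
  refine Real.exp_le_exp.2 ?_
  have : Real.log 2 ≤ 1 := by linarith [Real.log_two_lt_d9]
  nlinarith

/-- Each of the three terms is at most α/8, where α = 2^{-L/64}: the two exponential ones are at
most e^{-L}, and 1/p ≤ 2^{-L/32} = α². -/
lemma error_terms_le {p : ℕ} {L : ℝ} {s : ℕ} {r : ℝ} (hr1 : r ≤ 1) (hL : 1000 ≤ L)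
    (hp : (2 : ℝ) ^ (L / 32) ≤ p) (hs : L ≤ r * s) {κ m : ℝ} (hκ : κ = 2 * r) (hm : 1 ≤ m) :
    Real.exp (-(s * κ)) + 1 / p + (1 - r) ^ s / m ≤ (2 : ℝ) ^ (-(L / 64)) / 2 := by
  have e0 : Real.exp (-L) ≤ (2 : ℝ) ^ (-(L / 64)) / 8 := by
    have h8 : (2 : ℝ) ^ (-(L / 64)) / 8 = (2 : ℝ) ^ (-(L / 64) - 3) := by
      rw [Real.rpow_sub (by norm_num)]; norm_num
    rw [h8]
    exact (exp_neg_le_two_rpow (by linarith)).trans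
      (Real.rpow_le_rpow_of_exponent_le (by norm_num) (by linarith))
  have e1 : Real.exp (-(s * κ)) ≤ Real.exp (-L) := Real.exp_le_exp.2 (by subst hκ; linarith)
  have e2 : (1 : ℝ) / p ≤ (2 : ℝ) ^ (-(L / 64)) / 8 := by
    have h8 : (2 : ℝ) ^ (-(L / 64)) / 8 = (2 : ℝ) ^ (-(L / 64) - 3) := by
      rw [Real.rpow_sub (by norm_num)]; norm_num
    rw [h8]
    calc (1 : ℝ) / p ≤ 1 / (2 : ℝ) ^ (L / 32) := by gcongr
      _ = (2 : ℝ) ^ (-(L / 32)) := by rw [Real.rpow_neg (by norm_num), one_div]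
      _ ≤ _ := Real.rpow_le_rpow_of_exponent_le (by norm_num) (by linarith)
  have e3 : (1 - r) ^ s / m ≤ Real.exp (-L) := by
    calc (1 - r) ^ s / m ≤ (1 - r) ^ s := div_le_self (pow_nonneg (by linarith) _) hm
      _ ≤ Real.exp (-r) ^ s := pow_le_pow_left₀ (by linarith) (Real.one_sub_le_exp_neg r) s
      _ = Real.exp (-(r * s)) := by rw [← Real.exp_nat_mul]; congr 1; ring
      _ ≤ _ := Real.exp_le_exp.2 (by linarith)
  linarith [Real.rpow_pos_of_pos (by norm_num : (0 : ℝ) < 2) (-(L / 64))]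

/-- To leading order the base-2 exponents are n/32 - n/8 for small supports and n + n/32 - 9n for
large ones. Everything else is a small multiple of n, so each part is at most half the target. -/
lemma union_bound_le {n b s : ℕ} {p : ℕ} {L D : ℝ} (hL : 1000 ≤ L) (hD : D = Real.logb 2 (n + 1))
    (hLn : L ^ 2 ≤ n / 1000) (hDL : D ≤ L / 1000) (hb : (b : ℝ) ≤ L / 128)
    (hs : (s : ℝ) ≤ n / L + 1) (hp : (p : ℝ) ≤ 2 * (2 : ℝ) ^ (L / 32)) :
    (n + 1 : ℝ) ^ b * ((n + 1 : ℝ) ^ s * (p : ℝ) ^ s * (9 / 10) ^ (n - b - 1) +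
        2 ^ n * (p : ℝ) ^ s * ((2 / 2 ^ 10) ^ (n - b - s) * ((2 : ℝ) ^ (-(L / 64)))⁻¹ ^ b))
      ≤ (2 : ℝ) ^ (-(n : ℝ) / 32) := by
  have h2 : (0 : ℝ) < 2 := by norm_num
  have hL0 : 0 < L := by linarith
  have hD0 : 0 ≤ D := hD ▸ Real.logb_nonneg (by norm_num) (by linarith [n.cast_nonneg (α := ℝ)])
  have hnpow : ∀ k : ℕ, (n + 1 : ℝ) ^ k = (2 : ℝ) ^ (D * k) := fun k => by
    rw [Real.rpow_mul h2.le, hD, Real.rpow_logb h2 (by norm_num) (by positivity),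
      Real.rpow_natCast]
  have hppow : (p : ℝ) ^ s ≤ (2 : ℝ) ^ ((L / 32 + 1) * s) := by
    rw [Real.rpow_mul h2.le, Real.rpow_natCast, Real.rpow_add h2, Real.rpow_one]
    exact pow_le_pow_left₀ (by positivity) (by linarith) s
  have hsub : ∀ k l : ℕ, (k : ℝ) - l ≤ ((k - l : ℕ) : ℝ) := fun k l => by
    rw [sub_le_iff_le_add]; exact_mod_cast le_tsub_add
  have hN1 : (n : ℝ) - b - 1 ≤ ((n - b - 1 : ℕ) : ℝ) := by
    have h3 := hsub (n - b) 1
    have h4 := hsub n b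
    push_cast at h3
    linarith
  have hN2 : (n : ℝ) - b - s ≤ ((n - b - s : ℕ) : ℝ) := by
    linarith [hsub (n - b) s, hsub n b]
  have h9 : (9 / 10 : ℝ) ^ (n - b - 1) ≤ (2 : ℝ) ^ (-(1 / 8) * ((n : ℝ) - b - 1)) := by
    -- Equivalent to (9/10)^8 ≤ 1/2.
    have h : (9 / 10 : ℝ) ≤ (2 : ℝ) ^ (-(1 / 8) : ℝ) := by
      refine le_of_pow_le_pow_left₀ (n := 8) (by norm_num) (by positivity) ?_
      rw [← Real.rpow_natCast ((2 : ℝ) ^ (-(1 / 8) : ℝ)), ← Real.rpow_mul h2.le]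
      norm_num
    calc (9 / 10 : ℝ) ^ (n - b - 1) ≤ ((2 : ℝ) ^ (-(1 / 8) : ℝ)) ^ (n - b - 1) := by gcongr
      _ = (2 : ℝ) ^ (-(1 / 8) * ((n - b - 1 : ℕ) : ℝ)) := by
          rw [Real.rpow_mul h2.le, Real.rpow_natCast]
      _ ≤ _ := Real.rpow_le_rpow_of_exponent_le (by norm_num) (by linarith)
  have h10 : (2 / 2 ^ 10 : ℝ) ^ (n - b - s) ≤ (2 : ℝ) ^ (-9 * ((n : ℝ) - b - s)) := by
    have h : (2 / 2 ^ 10 : ℝ) = (2 : ℝ) ^ (-9 : ℝ) := by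
      rw [Real.rpow_neg h2.le, show (9 : ℝ) = ((9 : ℕ) : ℝ) by norm_num, Real.rpow_natCast]
      norm_num
    rw [h, ← Real.rpow_natCast, ← Real.rpow_mul h2.le]
    exact Real.rpow_le_rpow_of_exponent_le (by norm_num) (by linarith)
  have hα : ((2 : ℝ) ^ (-(L / 64)))⁻¹ ^ b = (2 : ℝ) ^ (L / 64 * b) := by
    rw [← Real.rpow_neg h2.le, neg_neg, Real.rpow_mul h2.le, Real.rpow_natCast]
  have hn0 : (0 : ℝ) ≤ n := n.cast_nonneg
  have hb0 : (0 : ℝ) ≤ b := b.cast_nonneg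
  have hs0 : (0 : ℝ) ≤ s := s.cast_nonneg
  have hLn' : L ≤ n / 1000000 := by nlinarith
  have hsL : s * L ≤ n + L := by
    have h := mul_le_mul_of_nonneg_right hs hL0.le
    rwa [add_mul, div_mul_cancel₀ _ hL0.ne', one_mul] at h
  have hs' : (s : ℝ) ≤ n / 900 := by nlinarith
  have hDs : D * s ≤ n / 900 := by
    have := mul_le_mul_of_nonneg_right hDL hs0
    linarith
  have hDb : D * b ≤ n / 1000 := by
    have := mul_le_mul hDL hb hb0 (by positivity)
    nlinarith
  have hLb : L / 64 * b ≤ n / 1000 := by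
    have := mul_le_mul_of_nonneg_left hb (by positivity : 0 ≤ L / 64)
    nlinarith
  have hT1 : (n + 1 : ℝ) ^ b * ((n + 1 : ℝ) ^ s * (p : ℝ) ^ s * (9 / 10) ^ (n - b - 1))
      ≤ (2 : ℝ) ^ (-(n : ℝ) / 32 - 1) := by
    calc _ ≤ (2 : ℝ) ^ (D * b) * ((2 : ℝ) ^ (D * s) * (2 : ℝ) ^ ((L / 32 + 1) * s) *
          (2 : ℝ) ^ (-(1 / 8) * ((n : ℝ) - b - 1))) := by
          rw [hnpow, hnpow]; gcongr
      _ = (2 : ℝ) ^ (D * b + (D * s + (L / 32 + 1) * s + -(1 / 8) * ((n : ℝ) - b - 1))) := by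
          simp only [Real.rpow_add h2]
      _ ≤ _ := Real.rpow_le_rpow_of_exponent_le (by norm_num) (by nlinarith)
  have hT2 : (n + 1 : ℝ) ^ b * (2 ^ n * (p : ℝ) ^ s * ((2 / 2 ^ 10) ^ (n - b - s) *
      ((2 : ℝ) ^ (-(L / 64)))⁻¹ ^ b)) ≤ (2 : ℝ) ^ (-(n : ℝ) / 32 - 1) := by
    calc _ ≤ (2 : ℝ) ^ (D * b) * ((2 : ℝ) ^ (n : ℝ) * (2 : ℝ) ^ ((L / 32 + 1) * s) *
          ((2 : ℝ) ^ (-9 * ((n : ℝ) - b - s)) * (2 : ℝ) ^ (L / 64 * b))) := by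
          rw [hnpow, hα, Real.rpow_natCast]; gcongr
      _ = (2 : ℝ) ^ (D * b + ((n : ℝ) + (L / 32 + 1) * s +
          (-9 * ((n : ℝ) - b - s) + L / 64 * b))) := by
          simp only [Real.rpow_add h2]
      _ ≤ _ := Real.rpow_le_rpow_of_exponent_le (by norm_num) (by nlinarith)
  have hhalf : (2 : ℝ) ^ (-(n : ℝ) / 32 - 1) = (2 : ℝ) ^ (-(n : ℝ) / 32) / 2 := by
    rw [Real.rpow_sub h2, Real.rpow_one]
  rw [mul_add]
  linarith

end Asymptotics

theorem proposition3p3 :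
    ∃ N : ℕ, ∀ n : ℕ, N ≤ n → ∀ p : ℕ, p.Prime →
      primeSize n ≤ (p : ℝ) → (p : ℝ) ≤ 2 * primeSize n →
      (symmSignLaw n).real (orthEvent (ZMod p) (alphaParam n) (betaParam n) n)ᶜ
        ≤ (2 : ℝ) ^ (-(n : ℝ) / 32) := by
  obtain ⟨N, hN⟩ := Filter.eventually_atTop.1
    (eventually_scale_bounds (K := 1000) (ε := 1 / (16 * 4 ^ 10)) (by positivity))
  refine ⟨N + 1, fun n hn p hp hp1 hp2 => ?_⟩
  have : Fact p.Prime := ⟨hp⟩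
  obtain ⟨hL, hL2, hD⟩ := hN n (by omega)
  rw [primeSize_eq] at hp1 hp2
  set L := rootScale n with hLdef
  have hL0 : 0 < L := by linarith
  have hn0 : (0 : ℝ) ≤ n := n.cast_nonneg
  have hpne : p ≠ 2 := by
    rintro rfl
    have h1 : (2 : ℝ) ^ (2 : ℝ) ≤ (2 : ℝ) ^ (L / 32) :=
      Real.rpow_le_rpow_of_exponent_le (by norm_num) (by linarith)
    rw [Real.rpow_two] at h1
    push_cast at hp1
    linarith
  have hceil := Nat.le_ceil ((n : ℝ) / L)
  -- Here b = ⌊βn⌋. The choice s ≈ n/L keeps p^s near 2^{n/32}, while L² ≤ rn with r = 1/(16·4^10)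
  -- ensures rs ≥ L for the error terms. With t = 10 the gain of 2^{-9} per row comfortably beats
  -- the 2^n supports.
  have hbound := symmSignLaw_orthEvent_compl_le (p := p) hpne (n := n) (b := ⌊L / 128⌋₊)
    (s := ⌈(n : ℝ) / L⌉₊) (t := 10) (α := alphaParam n) (β := betaParam n) (by norm_num)
    (by rw [alphaParam_eq]; positivity)
    (by rw [betaParam_mul (by omega)]; exact Nat.lt_floor_add_one _)
    (by
      rw [alphaParam_eq, neg_div, div_eq_mul_one_div]
      refine error_terms_le (r := 1 / (16 * 4 ^ 10)) (by norm_num) hL hp1 ?_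
        (by norm_num) (by norm_num)
      rw [div_le_iff₀ hL0] at hceil
      have : L * L ≤ 1 / (16 * 4 ^ 10) * ⌈(n : ℝ) / L⌉₊ * L := by
        rw [← sq, mul_assoc]
        exact hL2.trans (mul_le_mul_of_nonneg_left hceil (by norm_num))
      exact le_of_mul_le_mul_right this hL0)
  refine hbound.trans ?_
  rw [alphaParam_eq]
  exact union_bound_le hL rfl (by norm_num at hL2; linarith) (by norm_num at hD; linarith)
    (Nat.floor_le (by positivity)) (Nat.ceil_lt_add_one (by positivity)).le hp2
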